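/- Let $X$ be a finite alphabet, let $X^*$ be the rooted tree of finite words over $X$ (where $v$ is joined to $vx$ for $v\in X^*$, $x\in X$) and let $X^\omega$ be the set of infinite words over $X$, i.e. the boundary of the tree. For an automorphism $g\in\mathrm{Aut}(X^*)$ and $v\in X^*$, the section $g|_v\in\mathrm{Aut}(X^*)$ is defined by $g(vw)=g(v)\,g|_v(w)$ for all $w\in X^*$. The automorphism $g$ is finite-state if $\{g|_v : v\in X^*\}$ is finite, and $\alpha_n(g)$ denotes the number of words $v$ of length $n$ with $g|_v\neq 1$. Let $P_2(X)$ be the group of all finite-state $g\in\mathrm{Aut}(X^*)$ for which $\alpha_n(g)$ is bounded by a polynomial in $n$ of degree at most $2$. The action of a finitely generated group $G$ on an orbit is recurrent if, for a finite symmetric generating set $S$ of $G$, the simple random walk on the Schreier graph of this action (with the points of the orbit as vertices and an edge from $y$ to $s(y)$ for every $s\in S$ and every point $y$) returns to its starting point with probability $1$; this does not depend on the choice of $S$ or of the starting point in the orbit. **Theorem.** Let $G\le P_2(X)$ be a finitely generated group such that for every $w\in X^\omega$ the action of $G$ on the orbit $G(w)$ is recurrent. Then $G$ is amenable, i.e.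 there is a finitely additive map $m$ from the set of all subsets of $G$ to $[0,1]$ with $m(G)=1$ and $m(gA)=m(A)$ for all $g\in G$ and $A\subseteq G$. -/

import Mathlib

namespace RootedTree

/-! ### Amenability -/

/-- An action of a group `G` on a set `Y` is amenable if there is an invariant mean: a finitely
additive map `m` from all subsets of `Y` to `[0, 1]` with `m Y = 1` and `m (g A) = m A`. -/
def IsAmenableAction (G Y : Type*) [Group G] [MulAction G Y] : Prop :=
  ∃ m : Set Y → ℝ, (∀ A, m A ∈ Set.Icc (0 : ℝ) 1) ∧ m Set.univ = 1 ∧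
    (∀ A B, Disjoint A B → m (A ∪ B) = m A + m B) ∧
    ∀ (g : G) (A : Set Y), m ((fun y => g • y) '' A) = m A

/-- A (discrete) group is amenable if its action on itself by left multiplication is amenable. -/
def IsAmenableGroup (G : Type*) [Group G] : Prop := IsAmenableAction G G

/-! ### Recurrence of Schreier graphs -/

open Classical in
/-- The Schreier graph of an action of `G` on `Y` with respect to a finite set `S ⊆ G` has vertex
set `Y` and edge set `S × Y`, where `(s, y)` joins `y` to `s • y`. The simple random walk on it
moves from `y` to `s • y` with `s` uniformly distributed in `S`.
`visitProb S y₀ n y` is the probability that the walk started at `y` is at `y₀` at one (or more)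
of the times `1, …, n`; the recursion conditions on the first step. -/
noncomputable def visitProb {G Y : Type*} [Group G] [MulAction G Y] (S : Finset G) (y₀ : Y) :
    ℕ → Y → ℝ
  | 0, _ => 0
  | n + 1, y => (∑ s ∈ S, if s • y = y₀ then 1 else visitProb S y₀ n (s • y)) / (S.card : ℝ)

/-- The simple random walk on the (connected) Schreier graph of a transitive action of `G` on `Y`
with respect to `S` is recurrent: for some vertex `y₀`, the probability that the walk started
at `y₀` ever returns to `y₀` is `1`. -/
def IsRecurrentSchreierGraph (G Y : Type*) [Group G] [MulAction G Y] [MulAction.IsPretransitive G Y]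
    (S : Finset G) : Prop :=
  ∃ y₀ : Y, Filter.Tendsto (fun n => visitProb S y₀ n y₀) Filter.atTop (nhds 1)

/-- A transitive action of a finitely generated group is recurrent if its Schreier graph with
respect to a finite symmetric generating set is recurrent. (It is a standard fact that this
does not depend on the choice of the generating set.) -/
def IsRecurrentAction (G Y : Type*) [Group G] [MulAction G Y] [MulAction.IsPretransitive G Y] :
    Prop :=
  ∃ S : Finset G, (∀ s ∈ S, s⁻¹ ∈ S) ∧ Subgroup.closure (S : Set G) = ⊤ ∧
    IsRecurrentSchreierGraph G Y S

/-! ### The rooted tree of finite words and its automorphisms -/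

variable {X : Type*}

/-- The automorphism group of the rooted tree `X^*` of finite words over `X`: the permutations of
`X^*` that preserve the levels and the relation "`w` is a continuation of `v`". -/
def treeAut (X : Type*) : Subgroup (Equiv.Perm (List X)) where
  carrier := {g | (∀ v, (g v).length = v.length) ∧ ∀ v w, g v <+: g w ↔ v <+: w}
  one_mem' := by simp
  mul_mem' := by
    rintro a b ⟨ha, ha'⟩ ⟨hb, hb'⟩
    exact ⟨fun v => by simp [ha, hb], fun v w => by simp [ha', hb']⟩
  inv_mem' := by
    rintro a ⟨ha, ha'⟩
    refine ⟨fun v => ?_, fun v w => ?_⟩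
    · rw [← ha]; simp
    · rw [← ha']; simp

/-- The automorphism group of the rooted tree `X^*`, as a type. -/
abbrev TreeAut (X : Type*) : Type _ := treeAut X

namespace TreeAut

instance : CoeFun (TreeAut X) (fun _ => List X → List X) := ⟨fun g => (g : Equiv.Perm (List X))⟩

@[ext] theorem ext {g h : TreeAut X} (H : ∀ v, g v = h v) : g = h :=
  Subtype.ext (Equiv.ext H)

@[simp] theorem length_apply (g : TreeAut X) (v : List X) : (g v).length = v.length := g.2.1 v

theorem prefix_iff (g : TreeAut X) {v w : List X} : g v <+: g w ↔ v <+: w := g.2.2 v w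

@[simp] theorem mul_apply' (g h : TreeAut X) (v : List X) : (g * h) v = g (h v) := rfl

@[simp] theorem one_apply' (v : List X) : (1 : TreeAut X) v = v := rfl

@[simp] theorem inv_apply_self' (g : TreeAut X) (v : List X) : g⁻¹ (g v) = v :=
  Equiv.symm_apply_apply (g : Equiv.Perm (List X)) v

@[simp] theorem apply_inv_self' (g : TreeAut X) (v : List X) : g (g⁻¹ v) = v :=
  Equiv.apply_symm_apply (g : Equiv.Perm (List X)) v

theorem apply_append (g : TreeAut X) (v w : List X) :
    g (v ++ w) = g v ++ (g (v ++ w)).drop v.length := by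
  obtain ⟨t, ht⟩ := (prefix_iff g).2 (List.prefix_append v w)
  rw [← ht, ← length_apply g v, List.drop_left]

/-- The section `g|_v`, determined by `g (v w) = g v · g|_v w` for all words `w`
(see `TreeAut.apply_append_sect`). -/
def sect (g : TreeAut X) (v : List X) : TreeAut X :=
  ⟨{ toFun := fun w => (g (v ++ w)).drop v.length
     invFun := fun w => (g⁻¹ (g v ++ w)).drop v.length
     left_inv := fun w => by
      simp only
      rw [← apply_append, inv_apply_self', List.drop_left]
     right_inv := fun w => by
      have h := apply_append g⁻¹ (g v) w
      rw [inv_apply_self', length_apply] at h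
      simp only
      rw [← h, apply_inv_self', ← length_apply g v, List.drop_left] },
   by
    refine ⟨fun w => by simp, fun w w' => ?_⟩
    simp only [Equiv.coe_fn_mk]
    rw [← List.prefix_append_right_inj (g v), ← apply_append, ← apply_append, prefix_iff,
      List.prefix_append_right_inj]⟩

theorem apply_append_sect (g : TreeAut X) (v w : List X) : g (v ++ w) = g v ++ g.sect v w :=
  apply_append g v w

theorem mul_sect (g h : TreeAut X) (v : List X) :
    (g * h).sect v = g.sect (h v) * h.sect v := by
  ext1 w
  apply List.append_cancel_left (as := (g * h) v)
  rw [← apply_append_sect]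
  simp only [mul_apply']
  rw [apply_append_sect h, apply_append_sect g]

@[simp] theorem one_sect (v : List X) : (1 : TreeAut X).sect v = 1 := by
  ext1 w
  apply List.append_cancel_left (as := (1 : TreeAut X) v)
  rw [← apply_append_sect]
  rfl

theorem inv_sect (g : TreeAut X) (v : List X) : g⁻¹.sect v = (g.sect (g⁻¹ v))⁻¹ := by
  have h := mul_sect g g⁻¹ v
  rw [mul_inv_cancel, one_sect] at h
  exact eq_inv_of_mul_eq_one_right h.symm

/-- `g` is finite-state if it has only finitely many different sections. -/
def IsFiniteState (g : TreeAut X) : Prop := (Set.range g.sect).Finite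

/-- The activity `α_n(g)`: the number of words `v` of length `n` with `g|_v ≠ 1`. -/
noncomputable def activity (g : TreeAut X) (n : ℕ) : ℕ :=
  Set.ncard {v : List X | v.length = n ∧ g.sect v ≠ 1}

theorem finite_active [Finite X] (g : TreeAut X) (n : ℕ) :
    {v : List X | v.length = n ∧ g.sect v ≠ 1}.Finite :=
  (List.finite_length_eq X n).subset fun _ h => h.1

theorem activity_one (n : ℕ) : (1 : TreeAut X).activity n = 0 := by
  simp [activity]

theorem activity_mul_le [Finite X] (g h : TreeAut X) (n : ℕ) :
    (g * h).activity n ≤ g.activity n + h.activity n := by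
  have hsub : {v : List X | v.length = n ∧ (g * h).sect v ≠ 1} ⊆
      (h⁻¹ : TreeAut X) '' {v : List X | v.length = n ∧ g.sect v ≠ 1} ∪
        {v : List X | v.length = n ∧ h.sect v ≠ 1} := by
    rintro v ⟨hv, hne⟩
    by_cases hh : h.sect v = 1
    · refine Or.inl ⟨h v, ⟨by simp [hv], fun hg => hne ?_⟩, by simp⟩
      rw [mul_sect, hg, hh, one_mul]
    · exact Or.inr ⟨hv, hh⟩
  have hfin := (g.finite_active n).image (h⁻¹ : TreeAut X)
  refine (Set.ncard_le_ncard hsub (hfin.union (h.finite_active n))).trans ?_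
  exact (Set.ncard_union_le _ _).trans
    (Nat.add_le_add_right (Set.ncard_image_le (g.finite_active n)) _)

theorem activity_inv_le [Finite X] (g : TreeAut X) (n : ℕ) : g⁻¹.activity n ≤ g.activity n := by
  have hsub : {v : List X | v.length = n ∧ g⁻¹.sect v ≠ 1} ⊆
      g '' {v : List X | v.length = n ∧ g.sect v ≠ 1} := by
    rintro v ⟨hv, hne⟩
    refine ⟨g⁻¹ v, ⟨(length_apply g⁻¹ v).trans hv, fun h => hne ?_⟩, apply_inv_self' g v⟩
    rw [inv_sect, h, inv_one]
  exact (Set.ncard_le_ncard hsub ((g.finite_active n).image g)).trans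
    (Set.ncard_image_le (g.finite_active n))

end TreeAut

/-- The group `P_d(X)` of finite-state automorphisms `g` of `X^*` such that `α_n(g)` is bounded by
a polynomial in `n` of degree at most `d`. -/
def polyActivity (X : Type*) [Finite X] (d : ℕ) : Subgroup (TreeAut X) where
  carrier := {g | g.IsFiniteState ∧
    ∃ p : Polynomial ℝ, p.natDegree ≤ d ∧ ∀ n : ℕ, (g.activity n : ℝ) ≤ p.eval (n : ℝ)}
  one_mem' := by
    refine ⟨?_, 0, by simp, fun n => by simp [TreeAut.activity_one]⟩
    exact (Set.finite_singleton (1 : TreeAut X)).subset (by rintro _ ⟨v, rfl⟩; simp)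
  mul_mem' := by
    rintro a b ⟨ha, p, hp, hap⟩ ⟨hb, q, hq, hbq⟩
    refine ⟨?_, p + q, (Polynomial.natDegree_add_le p q).trans (max_le hp hq), fun n => ?_⟩
    · refine (Set.Finite.mul ha hb).subset ?_
      rintro _ ⟨v, rfl⟩
      exact ⟨_, ⟨b v, rfl⟩, _, ⟨v, rfl⟩, (TreeAut.mul_sect a b v).symm⟩
    · rw [Polynomial.eval_add]
      exact le_trans (by exact_mod_cast TreeAut.activity_mul_le a b n) (add_le_add (hap n) (hbq n))
  inv_mem' := by
    rintro a ⟨ha, p, hp, hap⟩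
    refine ⟨?_, p, hp, fun n => ?_⟩
    · refine (Set.Finite.inv ha).subset ?_
      rintro _ ⟨v, rfl⟩
      rw [Set.mem_inv, TreeAut.inv_sect, inv_inv]
      exact ⟨_, rfl⟩
    · exact le_trans (by exact_mod_cast TreeAut.activity_inv_le a n) (hap n)

/-! ### The action on the boundary of the tree -/

/-- The boundary `X^ω` of the tree: infinite words `w 0, w 1, w 2, …` over `X`. -/
def Boundary (X : Type*) : Type _ := ℕ → X

namespace Boundary

/-- The beginning of length `n` of an infinite word. -/
def pre (w : Boundary X) (n : ℕ) : List X := List.ofFn fun i : Fin n => w i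

@[simp] theorem length_pre (w : Boundary X) (n : ℕ) : (w.pre n).length = n := by simp [pre]

theorem pre_prefix (w : Boundary X) {m n : ℕ} (h : m ≤ n) : w.pre m <+: w.pre n := by
  obtain ⟨k, rfl⟩ := Nat.exists_eq_add_of_le h
  simp [pre, List.ofFn_add]

/-- Tree automorphisms act on infinite words letter by letter along the beginnings: the beginnings
of `g • w` are the images under `g` of the beginnings of `w` (see `Boundary.pre_smul`). -/
instance : SMul (TreeAut X) (Boundary X) :=
  ⟨fun g w n => (g (w.pre (n + 1)))[n]'(by simp)⟩

theorem smul_apply (g : TreeAut X) (w : Boundary X) (n : ℕ) :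
    (g • w) n = (g (w.pre (n + 1)))[n]'(by simp) := rfl

theorem pre_smul (g : TreeAut X) (w : Boundary X) (n : ℕ) : (g • w).pre n = g (w.pre n) := by
  apply List.ext_getElem (by simp)
  intro i h₁ h₂
  have hi : i < n := by simpa using h₁
  have hp : g (w.pre (i + 1)) <+: g (w.pre n) := (g.prefix_iff).2 (w.pre_prefix hi)
  rw [← hp.getElem (by simp : i < _)]
  simp [pre, smul_apply]

instance : MulAction (TreeAut X) (Boundary X) where
  one_smul w := by
    funext n
    simp [smul_apply, pre, -List.ofFn_succ]
  mul_smul g h w := by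
    funext n
    simp only [smul_apply, pre_smul, TreeAut.mul_apply']

end Boundary

end RootedTree

/-! Amenability is handled through Reiter's condition: almost invariant finitely supported
probability measures. An action is extensively amenable (`ExtAmen`) if there are almost invariant
random finite multisets of points that surely contain a prescribed point.

Recurrence implies this (`IsRecurrentAction.extAmen`). The probability `f` of reaching `y₀` within
`n` steps has finite support and value `1` at `y₀`, and its Dirichlet energy is at most a multiple
of the probability of no return within `n + 1` steps. Choosing each point `y` independently with
probability sin² (π f(y) / 2) gives a random set containing `y₀` that is moved little when the
energy is small.

On the tree side, activity bounded by a polynomial of degree `d` places a finite-state automorphism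
in `Deg (d + 1)`: otherwise nested cycles of states force activity of order `n ^ (d + 1)`
(`choose_le_activity`).

The core is an induction on `e` (`amen_of_deg`): a group of finite-state automorphisms in `Deg e`
acting extensively amenably on the boundary is amenable. For `e = 0` it is locally finite. For `e +
1`, let `G` act on its germs modulo germs of degree `e`. This action is again extensively amenable
(`extAmen_germs`): over a boundary point it is governed by sections that reproduce themselves along
a word `v`, and a group of such sections is, up to finite index, determined by its sections off `v`,
which have degree `e` (`amen_of_cycle`). The set of unit germs is commensurated, since each element
has only finitely many points of higher degree, and its stabilizer lies in `Deg e`. Now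
`ExtAmen.amen_of_commensurated` applies. -/

/-! ### Finitely supported functions with the `ℓ¹`-norm -/

namespace FinMeasure

open Finsupp

variable {Y Z W : Type*}

/-- The `ℓ¹`-norm of a finitely supported function. -/
noncomputable def l1 (p : Y →₀ ℝ) : ℝ := ∑ y ∈ p.support, |p y|

theorem l1_eq_sum {p : Y →₀ ℝ} {V : Finset Y} (h : p.support ⊆ V) : l1 p = ∑ y ∈ V, |p y| :=
  Finset.sum_subset h fun y _ hy => by simp [notMem_support_iff.1 hy]

theorem l1_nonneg (p : Y →₀ ℝ) : 0 ≤ l1 p := Finset.sum_nonneg fun _ _ => abs_nonneg _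

@[simp] theorem l1_zero : l1 (0 : Y →₀ ℝ) = 0 := by simp [l1]

theorem l1_add_le (p q : Y →₀ ℝ) : l1 (p + q) ≤ l1 p + l1 q := by
  classical
  rw [l1_eq_sum (support_add : (p + q).support ⊆ _),
    l1_eq_sum (Finset.subset_union_left : p.support ⊆ p.support ∪ q.support),
    l1_eq_sum (Finset.subset_union_right : q.support ⊆ p.support ∪ q.support),
    ← Finset.sum_add_distrib]
  exact Finset.sum_le_sum fun y _ => abs_add_le _ _

theorem l1_smul (a : ℝ) (p : Y →₀ ℝ) : l1 (a • p) = |a| * l1 p := by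
  rw [l1_eq_sum (support_smul : (a • p).support ⊆ _), l1, Finset.mul_sum]
  simp [abs_mul]

theorem l1_neg (p : Y →₀ ℝ) : l1 (-p) = l1 p := by
  simp [l1]

theorem l1_sub_comm (p q : Y →₀ ℝ) : l1 (p - q) = l1 (q - p) := by
  rw [← l1_neg, neg_sub]

theorem l1_sub_le (p q r : Y →₀ ℝ) : l1 (p - r) ≤ l1 (p - q) + l1 (q - r) := by
  simpa using l1_add_le (p - q) (q - r)

theorem l1_sum_le {ι : Type*} (s : Finset ι) (f : ι → Y →₀ ℝ) :
    l1 (∑ i ∈ s, f i) ≤ ∑ i ∈ s, l1 (f i) := by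
  classical
  induction s using Finset.induction_on with
  | empty => simp
  | insert i s hi ih =>
    rw [Finset.sum_insert hi, Finset.sum_insert hi]
    exact (l1_add_le _ _).trans (by gcongr)

@[simp] theorem l1_single (y : Y) (a : ℝ) : l1 (single y a) = |a| := by
  rw [l1_eq_sum (support_single_subset : (single y a).support ⊆ {y})]
  simp

/-- The total mass. -/
noncomputable def mass : (Y →₀ ℝ) →ₗ[ℝ] ℝ := linearCombination ℝ fun _ => (1 : ℝ)

theorem mass_eq (p : Y →₀ ℝ) : mass p = ∑ y ∈ p.support, p y := by
  simp [mass, linearCombination_apply, Finsupp.sum]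

@[simp] theorem mass_single (y : Y) (a : ℝ) : mass (single y a) = a := by
  simp [mass]

/-- The mixture of the `κ y` with the weights `p y`. -/
noncomputable def bind (p : Y →₀ ℝ) (κ : Y → Z →₀ ℝ) : Z →₀ ℝ := linearCombination ℝ κ p

theorem bind_eq_sum (p : Y →₀ ℝ) (κ : Y → Z →₀ ℝ) :
    bind p κ = ∑ y ∈ p.support, p y • κ y := by
  simp [bind, linearCombination_apply, Finsupp.sum]

@[simp] theorem bind_single (y : Y) (a : ℝ) (κ : Y → Z →₀ ℝ) : bind (single y a) κ = a • κ y := by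
  simp [bind]

theorem bind_sub_left (p q : Y →₀ ℝ) (κ : Y → Z →₀ ℝ) :
    bind (p - q) κ = bind p κ - bind q κ := by
  simp [bind]

theorem bind_sub_right (p : Y →₀ ℝ) (κ κ' : Y → Z →₀ ℝ) :
    bind p (fun y => κ y - κ' y) = bind p κ - bind p κ' := by
  simp [bind_eq_sum, smul_sub, Finset.sum_sub_distrib]

theorem map_bind {E : Type*} [AddCommGroup E] [Module ℝ E] (L : (Z →₀ ℝ) →ₗ[ℝ] E) (p : Y →₀ ℝ)
    (κ : Y → Z →₀ ℝ) : L (bind p κ) = ∑ y ∈ p.support, p y • L (κ y) := by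
  simp [bind_eq_sum]

theorem bind_bind (p : Y →₀ ℝ) (κ : Y → Z →₀ ℝ) (η : Z → W →₀ ℝ) :
    bind (bind p κ) η = bind p fun y => bind (κ y) η := by
  rw [bind_eq_sum p fun y => bind (κ y) η]
  exact map_bind (linearCombination ℝ η) p κ

theorem bind_comm (p : Y →₀ ℝ) (q : Z →₀ ℝ) (η : Y → Z → W →₀ ℝ) :
    bind p (fun y => bind q (η y)) = bind q fun z => bind p fun y => η y z := by
  simp only [bind_eq_sum, Finset.smul_sum]
  rw [Finset.sum_comm]
  simp_rw [smul_smul, mul_comm]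

theorem l1_bind_le (p : Y →₀ ℝ) (κ : Y → Z →₀ ℝ) {c : ℝ} (h : ∀ y ∈ p.support, l1 (κ y) ≤ c) :
    l1 (bind p κ) ≤ l1 p * c := by
  rw [show l1 p * c = ∑ y ∈ p.support, |p y| * c by rw [l1, Finset.sum_mul], bind_eq_sum]
  refine (l1_sum_le _ _).trans (Finset.sum_le_sum fun y hy => ?_)
  rw [l1_smul]
  exact mul_le_mul_of_nonneg_left (h y hy) (abs_nonneg _)

theorem mapDomain_eq_bind (f : Y → Z) (p : Y →₀ ℝ) :
    mapDomain f p = bind p fun y => single (f y) 1 := by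
  simp [bind_eq_sum, mapDomain, Finsupp.sum]

theorem mapDomain_bind (f : Z → W) (p : Y →₀ ℝ) (κ : Y → Z →₀ ℝ) :
    mapDomain f (bind p κ) = bind p fun y => mapDomain f (κ y) := by
  simp_rw [mapDomain_eq_bind f, bind_bind]

theorem bind_mapDomain (f : Y → Z) (p : Y →₀ ℝ) (κ : Z → W →₀ ℝ) :
    bind (mapDomain f p) κ = bind p fun y => κ (f y) := by
  simp [mapDomain_eq_bind f, bind_bind]

theorem l1_mapDomain_le (f : Y → Z) (p : Y →₀ ℝ) : l1 (mapDomain f p) ≤ l1 p := by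
  rw [mapDomain_eq_bind]
  simpa using l1_bind_le p (fun y => single (f y) (1 : ℝ)) (c := 1) (by simp)

theorem mapDomain_sub (f : Y → Z) (p q : Y →₀ ℝ) :
    mapDomain f (p - q) = mapDomain f p - mapDomain f q := by
  simp only [mapDomain_eq_bind, bind_sub_left]

theorem exists_mem_support_of_mem_support_bind {p : Y →₀ ℝ} {κ : Y → Z →₀ ℝ} {z : Z}
    (h : z ∈ (bind p κ).support) : ∃ y ∈ p.support, z ∈ (κ y).support := by
  contrapose! h
  rw [notMem_support_iff, bind_eq_sum, Finsupp.finsetSum_apply]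
  refine Finset.sum_eq_zero fun y hy => ?_
  simp [notMem_support_iff.1 (h y hy)]

/-- Finitely supported probability measures. -/
structure IsProb (p : Y →₀ ℝ) : Prop where
  mass_eq_one : mass p = 1
  l1_le_one : l1 p ≤ 1

/-- The nonnegative numbers `|p y| - p y` have sum at most `0`. Mass and norm serve as the
definition because both pass through mixtures by linearity and the triangle inequality. -/
theorem IsProb.nonneg {p : Y →₀ ℝ} (hp : IsProb p) (y : Y) : 0 ≤ p y := by
  have h : ∑ y ∈ p.support, (|p y| - p y) ≤ 0 := by
    rw [Finset.sum_sub_distrib, ← mass_eq, hp.mass_eq_one]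
    linarith [hp.l1_le_one, show l1 p = ∑ y ∈ p.support, |p y| from rfl]
  by_cases hy : y ∈ p.support
  · have h1 := Finset.single_le_sum (f := fun y => |p y| - p y)
      (fun i _ => sub_nonneg.2 (le_abs_self (p i))) hy
    have h2 : |p y| - p y ≤ 0 := h1.trans h
    exact (abs_nonneg _).trans (by linarith)
  · simp [notMem_support_iff.1 hy]

theorem isProb_of_nonneg {p : Y →₀ ℝ} (h : ∀ y, 0 ≤ p y) (h1 : mass p = 1) : IsProb p :=
  ⟨h1, by rw [← h1, mass_eq, l1]; exact (Finset.sum_congr rfl fun y _ => abs_of_nonneg (h y)).le⟩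

theorem isProb_single (y : Y) : IsProb (single y (1 : ℝ)) := ⟨by simp, by simp⟩

theorem IsProb.bind {p : Y →₀ ℝ} (hp : IsProb p) {κ : Y → Z →₀ ℝ}
    (hκ : ∀ y ∈ p.support, IsProb (κ y)) : IsProb (bind p κ) := by
  constructor
  · rw [map_bind, Finset.sum_congr rfl fun y hy => by rw [(hκ y hy).mass_eq_one]]
    simpa [mass_eq] using hp.mass_eq_one
  · simpa using (l1_bind_le p κ fun y hy => (hκ y hy).l1_le_one).trans
      (by simpa using hp.l1_le_one)

theorem IsProb.mapDomain {p : Y →₀ ℝ} (hp : IsProb p) (f : Y → Z) :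
    IsProb (mapDomain f p) := by
  rw [mapDomain_eq_bind]
  exact hp.bind fun y _ => isProb_single _

theorem IsProb.nonempty {p : Y →₀ ℝ} (hp : IsProb p) : p.support.Nonempty := by
  rw [Finset.nonempty_iff_ne_empty]
  intro h
  have := hp.mass_eq_one
  rw [support_eq_empty.1 h] at this
  simp at this

/-- The uniform distribution on a nonempty finite multiset. -/
theorem isProb_uniform (f : Multiset Y) (hf : f ≠ 0) :
    IsProb ((f.card : ℝ)⁻¹ • (f.map fun y => single y (1 : ℝ)).sum) := by
  have h : ∀ f : Multiset Y, mass (f.map fun y => single y (1 : ℝ)).sum = f.card ∧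
      ∀ y, 0 ≤ (f.map fun y => single y (1 : ℝ)).sum y := by
    intro f
    induction f using Multiset.induction_on with
    | empty => simp
    | cons a f ih =>
      refine ⟨by simp [ih.1, add_comm], fun y => ?_⟩
      simp only [Multiset.map_cons, Multiset.sum_cons, Finsupp.add_apply]
      refine add_nonneg ?_ (ih.2 y)
      classical
      rw [single_apply]
      split_ifs <;> norm_num
  refine isProb_of_nonneg (fun y => ?_) ?_
  · rw [Finsupp.smul_apply, smul_eq_mul]
    exact mul_nonneg (by positivity) ((h f).2 y)
  · rw [map_smul, (h f).1, smul_eq_mul, inv_mul_cancel₀]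
    exact_mod_cast (Multiset.card_pos.2 hf).ne'

/-! ### Translates -/

variable {G : Type*} [Group G] [MulAction G Y] [MulAction G Z]

/-- The translate of a finitely supported measure. -/
noncomputable def act (g : G) (p : Y →₀ ℝ) : Y →₀ ℝ := mapDomain (fun y => g • y) p

theorem act_mul (g h : G) (p : Y →₀ ℝ) : act (g * h) p = act g (act h p) := by
  simp only [act, ← mapDomain_comp]
  congr 1
  funext y
  simp [mul_smul]

@[simp] theorem act_one (p : Y →₀ ℝ) : act (1 : G) p = p := by
  simp only [act, one_smul]
  exact mapDomain_id

@[simp] theorem act_single (g : G) (y : Y) (a : ℝ) : act g (single y a) = single (g • y) a := by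
  simp [act]

theorem act_sub (g : G) (p q : Y →₀ ℝ) : act g (p - q) = act g p - act g q := mapDomain_sub _ _ _

theorem l1_act_le (g : G) (p : Y →₀ ℝ) : l1 (act g p) ≤ l1 p := l1_mapDomain_le _ _

theorem IsProb.act {p : Y →₀ ℝ} (hp : IsProb p) (g : G) : IsProb (act g p) := hp.mapDomain _

theorem mem_support_act {g : G} {p : Y →₀ ℝ} {y : Y} (h : y ∈ (act g p).support) :
    ∃ z ∈ p.support, y = g • z := by
  classical
  obtain ⟨z, hz, rfl⟩ := Finset.mem_image.1 (mapDomain_support h)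
  exact ⟨z, hz, rfl⟩

/-- Mixing an almost invariant measure over an almost equivariant family. -/
theorem l1_act_bind_sub_le (s : G) {p : Y →₀ ℝ} (hp : IsProb p) {κ : Y → Z →₀ ℝ}
    (hκ : ∀ y, l1 (κ y) ≤ 1) {a b : ℝ} (ha : l1 (act s p - p) ≤ a)
    (hb : ∀ y ∈ p.support, l1 (act s (κ y) - κ (s • y)) ≤ b) :
    l1 (act s (FinMeasure.bind p κ) - FinMeasure.bind p κ) ≤ a + b := by
  -- The term inserted in between is the mixture of the `κ (s • y)` over `p`, which is also the
  -- mixture of `κ` over the translate of `p`.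
  have h : act s (FinMeasure.bind p κ) - FinMeasure.bind p κ =
      FinMeasure.bind (act s p - p) κ +
        FinMeasure.bind p (fun y => act s (κ y) - κ (s • y)) := by
    rw [bind_sub_left, bind_sub_right, act, act, mapDomain_bind, bind_mapDomain]
    simp only [act]
    abel
  rw [h]
  obtain ⟨y, hy⟩ := hp.nonempty
  have hb0 := (l1_nonneg _).trans (hb y hy)
  refine (l1_add_le _ _).trans (add_le_add ?_ ?_)
  · simpa using (l1_bind_le _ κ fun y _ => hκ y).trans (by simpa using ha)
  · exact (l1_bind_le _ _ hb).trans (by nlinarith [hp.l1_le_one])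

/-- Pushing an almost invariant measure forward under a map that is equivariant on the support. -/
theorem l1_act_mapDomain_sub_le (s : G) {p : Y →₀ ℝ} (hp : IsProb p) {f : Y → Z} {a : ℝ}
    (ha : l1 (act s p - p) ≤ a) (hf : ∀ y ∈ p.support, s • f y = f (s • y)) :
    l1 (act s (mapDomain f p) - mapDomain f p) ≤ a := by
  rw [mapDomain_eq_bind]
  simpa using l1_act_bind_sub_le s hp (κ := fun y => single (f y) (1 : ℝ)) (by simp) ha
    (b := 0) (fun y hy => by simp [hf y hy])

end FinMeasure

/-! ### Amenability by almost invariant measures -/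

namespace FinMeasure

open Finsupp MulAction

variable {G : Type*} [Group G]

/-- Almost invariant finitely supported probability measures exist. -/
def Reiter (G Y : Type*) [Group G] [MulAction G Y] : Prop :=
  ∀ (S : Finset G) (ε : ℝ), 0 < ε →
    ∃ p : Y →₀ ℝ, IsProb p ∧ ∀ s ∈ S, l1 (act s p - p) ≤ ε

/-- Reiter's condition for a group. -/
def Amen (G : Type*) [Group G] : Prop := Reiter G G

theorem act_mapDomain_hom {H Y Z : Type*} [Group H] [MulAction G Y] [MulAction H Z] (f : Z → Y)
    {g : G} {h : H} (hf : ∀ z, g • f z = f (h • z)) (p : Z →₀ ℝ) :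
    act g (mapDomain f p) = mapDomain f (act h p) := by
  simp only [act, ← mapDomain_comp]
  congr 1
  funext z
  exact hf z

theorem Amen.exists_of_subset {H : Subgroup G} (hH : Amen H) (T : Finset G)
    (hT : ∀ t ∈ T, t ∈ H) {ε : ℝ} (hε : 0 < ε) :
    ∃ q : G →₀ ℝ, IsProb q ∧ ∀ t ∈ T, l1 (act t q - q) ≤ ε := by
  classical
  obtain ⟨q, hq, hq'⟩ := hH (T.subtype (· ∈ H)) ε hε
  refine ⟨mapDomain Subtype.val q, hq.mapDomain _, fun t ht => ?_⟩
  rw [act_mapDomain_hom Subtype.val (h := (⟨t, hT t ht⟩ : H)) (fun z => rfl), ← mapDomain_sub]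
  exact (l1_mapDomain_le _ _).trans (hq' _ (by simpa using ht))

/-- Transporting almost invariant measures along an orbit. -/
theorem exists_equivariant_family {Y W : Type*} [MulAction G Y] [MulAction G W] (y₀ : Y)
    (Q : (W →₀ ℝ) → Prop)
    (h : ∀ T : Finset G, (∀ t ∈ T, t • y₀ = y₀) → ∀ ε : ℝ, 0 < ε →
      ∃ q : W →₀ ℝ, Q q ∧ IsProb q ∧ ∀ t ∈ T, l1 (act t q - q) ≤ ε)
    (S : Finset G) (B : Finset Y) {ε : ℝ} (hε : 0 < ε) :
    ∃ κ : Y → W →₀ ℝ, Q (κ y₀) ∧ (∀ y, IsProb (κ y)) ∧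
      ∀ s ∈ S, ∀ y ∈ B, y ∈ orbit G y₀ → l1 (act s (κ y) - κ (s • y)) ≤ ε := by
  classical
  -- A transversal of the orbit. Taking `1` at `y₀` makes `κ y₀` equal to `q`, so that `Q` is kept.
  have hex : ∀ y : Y, ∃ g : G, (y ∈ orbit G y₀ → g • y₀ = y) ∧ (y = y₀ → g = 1) := by
    intro y
    by_cases hy : y = y₀
    · exact ⟨1, fun _ => by simp [hy], fun _ => rfl⟩
    · by_cases hy' : y ∈ orbit G y₀
      · obtain ⟨g, hg⟩ := hy'
        exact ⟨g, fun _ => hg, fun h => (hy h).elim⟩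
      · exact ⟨1, fun h => (hy' h).elim, fun h => (hy h).elim⟩
  choose t ht ht1 using hex
  -- The cocycle of the transversal stabilizes `y₀` at orbit points. Only its finitely many values
  -- on `S ×ˢ B` matter, so a single `q` suffices.
  let τ : G × Y → G := fun x => (t (x.1 • x.2))⁻¹ * (x.1 * t x.2)
  obtain ⟨q, hQ, hq, hT⟩ := h (((S ×ˢ B).image τ).filter fun g => g • y₀ = y₀)
    (fun g hg => (Finset.mem_filter.1 hg).2) ε hε
  refine ⟨fun y => act (t y) q, ?_, fun y => hq.act _, fun s hs y hy hyo => ?_⟩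
  · simpa [ht1 y₀ rfl] using hQ
  · have hso : s • y ∈ orbit G y₀ := mem_orbit_of_mem_orbit s hyo
    have hfix : τ (s, y) • y₀ = y₀ := by
      simp only [τ, mul_smul, ht y hyo]
      rw [inv_smul_eq_iff, ht _ hso]
    have := hT (τ (s, y)) (Finset.mem_filter.2
      ⟨Finset.mem_image_of_mem _ (Finset.mk_mem_product hs hy), hfix⟩)
    have h2 : act s (act (t y) q) - act (t (s • y)) q =
        act (t (s • y)) (act (τ (s, y)) q - q) := by
      rw [act_sub, ← act_mul, ← act_mul]
      simp [τ]
    rw [h2]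
    exact (l1_act_le _ _).trans this

/-- A group is amenable if it has almost invariant measures on an action with amenable
stabilizers. -/
theorem amen_of_stabilizers {Y : Type*} [MulAction G Y]
    (h : ∀ (S : Finset G) (ε : ℝ), 0 < ε → ∃ p : Y →₀ ℝ, IsProb p ∧
      (∀ s ∈ S, l1 (act s p - p) ≤ ε) ∧
      ∀ y ∈ p.support, ∃ y' ∈ orbit G y, Amen (stabilizer G y')) : Amen G := by
  classical
  intro S ε hε
  obtain ⟨p, hp, hpS, hst⟩ := h S (ε / 2) (half_pos hε)
  -- One equivariant family per orbit; an orbit without an amenable stabilizer misses the support of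
  -- `p` and gets a dummy.
  have key : ∀ o : Quotient (orbitRel G Y), ∃ κ : Y → G →₀ ℝ, (∀ y, IsProb (κ y)) ∧
      ((∃ y', Quotient.mk (orbitRel G Y) y' = o ∧ Amen (stabilizer G y')) →
        ∀ s ∈ S, ∀ y ∈ p.support, Quotient.mk (orbitRel G Y) y = o →
          l1 (act s (κ y) - κ (s • y)) ≤ ε / 2) := by
    intro o
    by_cases ho : ∃ y', Quotient.mk (orbitRel G Y) y' = o ∧ Amen (stabilizer G y')
    · obtain ⟨y', rfl, hy'⟩ := ho
      obtain ⟨κ, -, hκ, hκS⟩ := exists_equivariant_family (W := G) y' (fun _ => True)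
        (fun T hT δ hδ => by simpa using hy'.exists_of_subset T hT hδ) S p.support (half_pos hε)
      exact ⟨κ, hκ, fun _ s hs y hy hyo => hκS s hs y hy (Quotient.exact hyo)⟩
    · exact ⟨fun _ => single 1 1, fun _ => isProb_single _, fun h => (ho h).elim⟩
  choose κ hκ hκS using key
  refine ⟨bind p fun y => κ (Quotient.mk _ y) y, hp.bind fun y _ => hκ _ _, fun s hs => ?_⟩
  have hsum : ε = ε / 2 + ε / 2 := by ring
  rw [hsum]
  refine l1_act_bind_sub_le s hp (fun y => (hκ _ _).l1_le_one) (hpS s hs) fun y hy => ?_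
  obtain ⟨y', hy', ham⟩ := hst y hy
  have : (Quotient.mk (orbitRel G Y) (s • y)) = Quotient.mk (orbitRel G Y) y :=
    Quotient.sound (mem_orbit y s)
  rw [this]
  exact hκS _ ⟨y', Quotient.sound hy', ham⟩ s hs y hy rfl

/-- `G` acts on `Q` through `f`, and every stabilizer is the kernel. -/
theorem Amen.of_hom {Q : Type*} [Group Q] (hQ : Amen Q) (f : G →* Q) (hf : Amen f.ker) :
    Amen G := by
  classical
  let := MulAction.compHom Q f
  refine amen_of_stabilizers (Y := Q) fun S ε hε => ?_
  obtain ⟨p, hp, hpS⟩ := hQ (S.image f) ε hε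
  refine ⟨p, hp, fun s hs => hpS _ (Finset.mem_image_of_mem f hs), fun y _ =>
    ⟨y, mem_orbit_self y, ?_⟩⟩
  have : stabilizer G y = f.ker := by
    ext g
    rw [mem_stabilizer_iff, MonoidHom.mem_ker, show g • y = f g * y from rfl, mul_eq_right]
  rwa [this]

theorem amen_of_subsingleton [Subsingleton G] : Amen G := fun S ε hε =>
  ⟨single 1 1, isProb_single _, fun s _ => by
    simp [Subsingleton.elim s 1, hε.le]⟩

theorem Amen.of_injective {H : Type*} [Group H] (hG : Amen G) (f : H →* G)
    (hf : Function.Injective f) : Amen H := by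
  refine hG.of_hom f ?_
  rw [(MonoidHom.ker_eq_bot_iff f).2 hf]
  exact amen_of_subsingleton

theorem amen_of_finite [Finite G] : Amen G := by
  have := Fintype.ofFinite G
  intro S ε hε
  let p : G →₀ ℝ := Finsupp.equivFunOnFinite.symm fun _ => (Fintype.card G : ℝ)⁻¹
  have hp : ∀ g, p g = (Fintype.card G : ℝ)⁻¹ := fun g => rfl
  have hpos : (0 : ℝ) < (Fintype.card G : ℝ)⁻¹ := inv_pos.2 (by exact_mod_cast Fintype.card_pos)
  refine ⟨p, isProb_of_nonneg (fun g => hpos.le) ?_, fun s _ => ?_⟩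
  · rw [mass_eq, Finset.sum_subset (Finset.subset_univ _)
      fun y _ hy => notMem_support_iff.1 hy]
    simp [hp]
  · have : act s p = p := by
      ext g
      have h := mapDomain_apply (MulAction.injective s) p (s⁻¹ • g)
      simp only [smul_inv_smul] at h
      rw [act, h, hp, hp]
    simp [this, hε.le]

theorem amen_of_locally (h : ∀ S : Finset G, ∃ H : Subgroup G, (∀ s ∈ S, s ∈ H) ∧ Amen H) :
    Amen G := fun S _ hε =>
  let ⟨_, hS, hH⟩ := h S
  hH.exists_of_subset S hS hε

/-- A group is amenable if it has amenable images under finitely many homomorphisms with trivial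
common kernel. -/
theorem amen_of_finset_hom {ι : Type*} {Q : ι → Type*} [∀ i, Group (Q i)] (I : Finset ι)
    (f : ∀ i, G →* Q i) (hf : ∀ i ∈ I, Amen (f i).range)
    (hinj : ∀ g, (∀ i ∈ I, f i g = 1) → g = 1) : Amen G := by
  classical
  -- Removing the index `i` replaces `H` by its intersection with the kernel of `f i`; `Amen.of_hom`
  -- climbs back.
  suffices h : ∀ (J : Finset ι), J ⊆ I → ∀ H : Subgroup G,
      (∀ g ∈ H, (∀ i ∈ J, f i g = 1) → g = 1) → Amen H by
    exact (h I subset_rfl ⊤ fun g _ => hinj g).of_injective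
      (Subgroup.topEquiv (G := G)).symm.toMonoidHom (Subgroup.topEquiv (G := G)).symm.injective
  intro J
  induction J using Finset.induction_on with
  | empty =>
    intro _ H hH
    have : Subsingleton H := ⟨fun a b => Subtype.ext
      ((hH a a.2 (by simp)).trans (hH b b.2 (by simp)).symm)⟩
    exact amen_of_subsingleton
  | insert i J hi ih =>
    intro hJ H hH
    refine (hf i (hJ (Finset.mem_insert_self _ _))).of_hom ((f i).rangeRestrict.comp H.subtype) ?_
    have h1 := ih ((Finset.subset_insert _ _).trans hJ) (H ⊓ (f i).ker) (fun g hg hgJ =>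
      hH g hg.1 (by simpa using ⟨hg.2, hgJ⟩))
    refine h1.of_injective ((Subgroup.subtype _).comp (Subgroup.subtype _) |>.codRestrict _
      fun g => ⟨g.1.2, ?_⟩) fun a b hab => ?_
    · exact congrArg Subtype.val (MonoidHom.mem_ker.1 g.2)
    · exact Subtype.ext (Subtype.ext (congrArg (fun x : ↥(H ⊓ (f i).ker) => (x : G)) hab :))

end FinMeasure

/-! ### Extensively amenable actions -/

namespace FinMeasure

open Finsupp MulAction

variable {G : Type*} [Group G]

instance multisetMulAction {Y : Type*} [MulAction G Y] : MulAction G (Multiset Y) where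
  smul g F := F.map fun y => g • y
  one_smul F := by
    change F.map (fun y => (1 : G) • y) = F
    simp
  mul_smul g h F := by
    change F.map (fun y => (g * h) • y) = (F.map fun y => h • y).map fun y => g • y
    simp [mul_smul]

/-! ### Independent sums of random finite multisets. -/

section Multiset

variable {Y Z : Type*} [MulAction G Y] [MulAction G Z]

theorem smul_multiset (g : G) (F : Multiset Y) : g • F = F.map fun y => g • y := rfl

theorem mem_smul_multiset {g : G} {F : Multiset Y} {y : Y} : y ∈ g • F ↔ g⁻¹ • y ∈ F := by
  rw [smul_multiset, Multiset.mem_map]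
  constructor
  · rintro ⟨z, hz, rfl⟩
    simpa
  · exact fun h => ⟨_, h, by simp⟩

theorem smul_mem_smul_multiset {g : G} {F : Multiset Y} {y : Y} (h : y ∈ F) : g • y ∈ g • F :=
  Multiset.mem_map_of_mem _ h

@[simp] theorem smul_multiset_add (g : G) (E F : Multiset Y) : g • (E + F) = g • E + g • F :=
  Multiset.map_add _ _ _

@[simp] theorem smul_multiset_zero (g : G) : g • (0 : Multiset Y) = 0 := rfl

/-- The distribution of the sum of two independent random multisets. -/
noncomputable def conv (p q : Multiset Y →₀ ℝ) : Multiset Y →₀ ℝ :=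
  bind p fun E => bind q fun F => single (E + F) 1

theorem IsProb.conv {p q : Multiset Y →₀ ℝ} (hp : IsProb p) (hq : IsProb q) :
    IsProb (conv p q) :=
  hp.bind fun _ _ => hq.bind fun _ _ => isProb_single _

theorem act_conv (g : G) (p q : Multiset Y →₀ ℝ) :
    act g (conv p q) = conv (act g p) (act g q) := by
  simp [conv, act, mapDomain_bind, bind_mapDomain]

theorem mem_support_conv {p q : Multiset Y →₀ ℝ} {R : Multiset Y}
    (h : R ∈ (conv p q).support) : ∃ E ∈ p.support, ∃ F ∈ q.support, R = E + F := by
  obtain ⟨E, hE, h⟩ := exists_mem_support_of_mem_support_bind h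
  obtain ⟨F, hF, h⟩ := exists_mem_support_of_mem_support_bind h
  exact ⟨E, hE, F, hF, Finset.mem_singleton.1 (support_single_subset h)⟩

/-- This makes the fold in `convProd` independent of the order of the factors. -/
theorem conv_left_comm (p q r : Multiset Y →₀ ℝ) :
    conv p (conv q r) = conv q (conv p r) := by
  simp only [conv, bind_bind, bind_single, one_smul]
  rw [bind_comm]
  simp_rw [add_left_comm]

instance : LeftCommutative (conv : (Multiset Y →₀ ℝ) → _ → _) := ⟨conv_left_comm⟩

theorem l1_conv_sub_le {p p' q q' : Multiset Y →₀ ℝ} (hp : l1 p ≤ 1) (hq : l1 q' ≤ 1) {a b : ℝ}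
    (ha : l1 (p - p') ≤ a) (hb : l1 (q - q') ≤ b) : l1 (conv p q - conv p' q') ≤ a + b := by
  have h : conv p q - conv p' q' =
      bind p (fun E => bind (q - q') fun F => single (E + F) 1) +
        bind (p - p') (fun E => bind q' fun F => single (E + F) 1) := by
    simp_rw [bind_sub_left, bind_sub_right]
    simp [conv]
  rw [h, add_comm a]
  refine (l1_add_le _ _).trans (add_le_add ?_ ?_)
  · have hb0 := (l1_nonneg _).trans hb
    refine (l1_bind_le _ _ (c := b) fun E _ => ?_).trans (by nlinarith)
    exact (l1_bind_le _ _ (c := 1) fun F _ => by simp).trans (by simpa using hb)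
  · refine (l1_bind_le _ _ (c := 1) fun E _ => ?_).trans (by simpa using ha)
    exact (l1_bind_le _ _ (c := 1) fun F _ => by simp).trans (by simpa using hq)

/-- The distribution of the sum of independent random multisets with the distributions `κ y`,
for `y ∈ F`. -/
noncomputable def convProd (κ : Y → Multiset Z →₀ ℝ) (F : Multiset Y) : Multiset Z →₀ ℝ :=
  (F.map κ).foldr conv (single 0 1)

@[simp] theorem convProd_zero (κ : Y → Multiset Z →₀ ℝ) : convProd κ 0 = single 0 1 := rfl

@[simp] theorem convProd_cons (κ : Y → Multiset Z →₀ ℝ) (y : Y) (F : Multiset Y) :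
    convProd κ (y ::ₘ F) = conv (κ y) (convProd κ F) := by
  simp [convProd]

theorem isProb_convProd {κ : Y → Multiset Z →₀ ℝ} (hκ : ∀ y, IsProb (κ y)) (F : Multiset Y) :
    IsProb (convProd κ F) := by
  induction F using Multiset.induction_on with
  | empty => exact isProb_single _
  | cons y F ih =>
    rw [convProd_cons]
    exact (hκ y).conv ih

theorem l1_act_convProd_sub_le {κ : Y → Multiset Z →₀ ℝ} (hκ : ∀ y, IsProb (κ y)) (s : G) {b : ℝ}
    (F : Multiset Y) (hb : ∀ y ∈ F, l1 (act s (κ y) - κ (s • y)) ≤ b) :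
    l1 (act s (convProd κ F) - convProd κ (s • F)) ≤ F.card * b := by
  induction F using Multiset.induction_on with
  | empty => simp
  | cons y F ih =>
    have h : s • (y ::ₘ F) = (s • y) ::ₘ (s • F) := Multiset.map_cons _ _ _
    rw [h, convProd_cons, convProd_cons, act_conv, Multiset.card_cons]
    refine (l1_conv_sub_le ((hκ y).act s).l1_le_one (isProb_convProd hκ _).l1_le_one
      (hb y (Multiset.mem_cons_self _ _))
      (ih fun z hz => hb z (Multiset.mem_cons_of_mem hz))).trans (le_of_eq ?_)
    push_cast
    ring

theorem exists_le_of_mem_support_convProd {κ : Y → Multiset Z →₀ ℝ} {F : Multiset Y} {y : Y}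
    (hy : y ∈ F) {R : Multiset Z} (hR : R ∈ (convProd κ F).support) :
    ∃ E ∈ (κ y).support, E ≤ R := by
  induction F using Multiset.induction_on generalizing R with
  | empty => simp at hy
  | cons z F ih =>
    rw [convProd_cons] at hR
    obtain ⟨E, hE, E', hE', rfl⟩ := mem_support_conv hR
    rcases Multiset.mem_cons.1 hy with rfl | hy
    · exact ⟨E, hE, Multiset.le_add_right _ _⟩
    · obtain ⟨D, hD, hDE⟩ := ih hy hE'
      exact ⟨D, hD, hDE.trans (Multiset.le_add_left _ _)⟩

end Multiset

/-- An action is extensively amenable if there are almost invariant measures on the finite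
(multi)sets of points that give full weight to those containing a given point. -/
def ExtAmen (G Y : Type*) [Group G] [MulAction G Y] : Prop :=
  ∀ (y : Y) (S : Finset G) (ε : ℝ), 0 < ε → ∃ p : Multiset Y →₀ ℝ, IsProb p ∧
    (∀ R ∈ p.support, y ∈ R) ∧ ∀ s ∈ S, l1 (act s p - p) ≤ ε

variable {Y Z : Type*} [MulAction G Y] [MulAction G Z]

theorem ExtAmen.exists_multiset (h : ExtAmen G Y) (E : Multiset Y) (S : Finset G) {ε : ℝ}
    (hε : 0 < ε) : ∃ p : Multiset Y →₀ ℝ, IsProb p ∧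
      (∀ R ∈ p.support, ∀ y ∈ E, y ∈ R) ∧ ∀ s ∈ S, l1 (act s p - p) ≤ ε := by
  induction E using Multiset.induction_on generalizing ε with
  | empty => exact ⟨single 0 1, isProb_single _, by simp, fun s _ => by simp [hε.le]⟩
  | cons y E ih =>
    obtain ⟨p, hp, hpE, hpS⟩ := ih (half_pos hε)
    obtain ⟨q, hq, hqy, hqS⟩ := h y S (ε / 2) (half_pos hε)
    refine ⟨conv q p, hq.conv hp, fun R hR z hz => ?_, fun s hs => ?_⟩
    · obtain ⟨F, hF, F', hF', rfl⟩ := mem_support_conv hR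
      rcases Multiset.mem_cons.1 hz with rfl | hz
      · exact Multiset.mem_add.2 (Or.inl (hqy _ hF))
      · exact Multiset.mem_add.2 (Or.inr (hpE _ hF' _ hz))
    · rw [act_conv]
      exact (l1_conv_sub_le (hq.act s).l1_le_one hp.l1_le_one (hqS s hs) (hpS s hs)).trans_eq
        (add_halves ε)

theorem ExtAmen.subgroup (h : ExtAmen G Y) (H : Subgroup G) : ExtAmen H Y := by
  classical
  intro y S ε hε
  obtain ⟨p, hp, hpy, hpS⟩ := h y (S.image Subtype.val) ε hε
  exact ⟨p, hp, hpy, fun s hs => hpS s (Finset.mem_image_of_mem _ hs)⟩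

/-- The stabilizer of a point with respect to an extensively amenable action is
co-amenable. -/
theorem ExtAmen.amen_of_stabilizer (h : ExtAmen G Y) (y : Y) (hy : Amen (stabilizer G y)) :
    Amen G := by
  classical
  refine amen_of_stabilizers (Y := Y) fun S ε hε => ?_
  obtain ⟨p, hp, hpy, hpS⟩ := h y S ε hε
  -- A uniformly chosen element of the part of `R` in the orbit of `y`. On the support of `p` this
  -- part contains `y`, so the default value is never met there and `κ` is exactly equivariant.
  let κ : Multiset Y → Y →₀ ℝ := fun R =>
    if R.filter (· ∈ orbit G y) = 0 then single y 1 else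
      ((R.filter (· ∈ orbit G y)).card : ℝ)⁻¹ •
        ((R.filter (· ∈ orbit G y)).map fun z => single z (1 : ℝ)).sum
  have hκ : ∀ R, IsProb (κ R) := fun R => by
    simp only [κ]
    split_ifs with hR
    · exact isProb_single _
    · exact isProb_uniform _ hR
  have hsupp : ∀ R, ∀ z ∈ (κ R).support, z ∈ orbit G y := by
    intro R z hz
    simp only [κ] at hz
    split_ifs at hz with hR
    · rw [Finset.mem_singleton.1 (support_single_subset hz)]
      exact mem_orbit_self y
    · by_contra hne
      refine (mem_support_iff.1 hz) ?_
      rw [Finsupp.smul_apply, ← Finsupp.applyAddHom_apply, map_multiset_sum,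
        Multiset.sum_eq_zero, smul_zero]
      simp only [Multiset.map_map, Multiset.mem_map, Function.comp_apply]
      rintro _ ⟨w, hw, rfl⟩
      rw [applyAddHom_apply, single_apply, if_neg]
      rintro rfl
      exact hne (Multiset.mem_filter.1 hw).2
  refine ⟨bind p κ, hp.bind fun R _ => hκ R, fun s hs => ?_, fun z hz => ?_⟩
  · rw [← add_zero ε]
    refine l1_act_bind_sub_le s hp (fun R => (hκ R).l1_le_one) (hpS s hs) fun R hR => ?_
    have h1 : (s • R).filter (· ∈ orbit G y) = s • R.filter (· ∈ orbit G y) := by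
      rw [smul_multiset, smul_multiset, Multiset.filter_map]
      congr 1
      refine Multiset.filter_congr fun z _ => ?_
      simp only [Function.comp_apply]
      exact ⟨fun h => by simpa using mem_orbit_of_mem_orbit s⁻¹ h, mem_orbit_of_mem_orbit s⟩
    have h2 : R.filter (· ∈ orbit G y) ≠ 0 := by
      intro h0
      have : y ∈ R.filter (· ∈ orbit G y) :=
        Multiset.mem_filter.2 ⟨hpy R hR, mem_orbit_self y⟩
      simp [h0] at this
    have h3 : s • R.filter (· ∈ orbit G y) ≠ 0 := by
      rwa [smul_multiset, Ne, Multiset.map_eq_zero]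
    simp only [κ, h1, if_neg h2, if_neg h3]
    refine le_of_eq ?_
    have h4 : ∀ F : Multiset Y, act s (F.map fun z => single z (1 : ℝ)).sum =
        ((s • F).map fun z => single z (1 : ℝ)).sum := fun F => by
      rw [act, ← mapDomain.addMonoidHom_apply, map_multiset_sum, smul_multiset]
      simp
    rw [act, mapDomain_smul, ← act, h4, smul_multiset, Multiset.card_map]
    simp
  · obtain ⟨R, _, hz⟩ := exists_mem_support_of_mem_support_bind hz
    exact ⟨y, mem_orbit_symm.1 (hsupp R z hz), hy⟩

/-- The points of `F` are fixed one at a time; `ExtAmen.amen_of_stabilizer` leads back from each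
stabilizer to the larger group. -/
theorem ExtAmen.amen_of_fixing (h : ExtAmen G Y) (F : Multiset Y) (H : Subgroup G)
    (hF : ∀ K : Subgroup G, K ≤ H → (∀ g ∈ K, ∀ y ∈ F, g • y = y) → Amen K) : Amen H := by
  induction F using Multiset.induction_on generalizing H with
  | empty => exact hF H le_rfl (by simp)
  | cons y F ih =>
    refine (h.subgroup H).amen_of_stabilizer y ?_
    have h1 : Amen ↥(H ⊓ stabilizer G y) := ih _ fun K hK hKF => hF K (hK.trans inf_le_left)
      fun g hg z hz => by
        rcases Multiset.mem_cons.1 hz with rfl | hz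
        · exact (hK hg).2
        · exact hKF g hg z hz
    refine h1.of_injective ((H.subtype.comp (Subgroup.subtype _)).codRestrict _
      fun g => ⟨g.1.2, g.2⟩) fun a b hab => ?_
    exact Subtype.ext (Subtype.ext
      (congrArg (fun x : ↥(H ⊓ stabilizer G y) => (x : G)) hab :))

open Pointwise in
/-- If a group acts extensively amenably and commensurates a set with amenable stabilizer,
then it is amenable. -/
theorem ExtAmen.amen_of_commensurated (h : ExtAmen G Z) (D : Set Z)
    (hD : ∀ g : G, {z | ¬ (g • z ∈ D ↔ z ∈ D)}.Finite)
    (hst : ∀ H : Subgroup G, (∀ g ∈ H, ∀ z, g • z ∈ D ↔ z ∈ D) → Amen H) : Amen G := by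
  classical
  refine amen_of_stabilizers (Y := Set Z) fun S ε hε => ?_
  obtain ⟨p, hp, hpE, hpS⟩ := h.exists_multiset (∑ s ∈ S, (hD s).toFinset.val) S hε
  refine ⟨mapDomain (fun R => D ∪ {z | z ∈ R}) p, hp.mapDomain _, fun s hs =>
    l1_act_mapDomain_sub_le s hp (hpS s hs) fun R hR => ?_, fun A hA => ⟨A, mem_orbit_self A, ?_⟩⟩
  -- `R` absorbs all points where `s` fails to preserve `D`, so `s` maps `D ∪ R` exactly to `D ∪ s •
  -- R`.
  · have hsR : ∀ z, ¬ (s • z ∈ D ↔ z ∈ D) → z ∈ R := fun z hz =>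
      hpE R hR z (Multiset.mem_sum.2 ⟨s, hs, by simpa using hz⟩)
    ext z
    simp only [Set.mem_smul_set_iff_inv_smul_mem, Set.mem_union, Set.mem_ofPred_eq,
      mem_smul_multiset]
    have := hsR (s⁻¹ • z)
    rw [smul_inv_smul] at this
    tauto
  · obtain ⟨R, -, rfl⟩ := Finset.mem_image.1 (mapDomain_support hA)
    -- An element that preserves `D ∪ R` and fixes `R` pointwise preserves `D`.
    refine h.amen_of_fixing R _ fun K hK hKR => hst K fun g hg z => ?_
    have h1 := mem_stabilizer_iff.1 (hK hg)
    have h2 : g • z ∈ D ∪ {z | z ∈ R} ↔ z ∈ D ∪ {z | z ∈ R} := by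
      conv_lhs => rw [← h1]
      exact Set.smul_mem_smul_set_iff
    by_cases hz : z ∈ R
    · rw [hKR g hg z hz]
    · have hz' : g • z ∉ R := fun hgz => hz (by
        have := hKR g⁻¹ (inv_mem hg) _ hgz
        rw [inv_smul_smul] at this
        rwa [← this] at hgz)
      simpa [hz, hz'] using h2

/-- Extensive amenability of an action fibered over an extensively amenable one. -/
theorem ExtAmen.of_fibration (h : ExtAmen G Y) (π : Z → Y)
    (hz : ∀ (z : Z) (T : Finset G), (∀ t ∈ T, t • π z = π z) → ∀ ε : ℝ, 0 < ε →
      ∃ q : Multiset Z →₀ ℝ, IsProb q ∧ (∀ R ∈ q.support, z ∈ R) ∧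
        ∀ t ∈ T, l1 (act t q - q) ≤ ε) : ExtAmen G Z := by
  classical
  intro z S ε hε
  obtain ⟨p, hp, hpz, hpS⟩ := h (π z) S (ε / 2) (half_pos hε)
  let B : Finset Y := p.support.biUnion fun F => F.toFinset
  -- Errors of the independent factors add up over the points of `F`, so each factor is made
  -- accurate to `ε / 2` divided by a bound for the cardinalities; the `1` keeps `n` positive.
  let n : ℝ := ∑ F ∈ p.support, (F.card : ℝ) + 1
  have hn : ∀ F ∈ p.support, (F.card : ℝ) ≤ n := fun F hF =>
    (Finset.single_le_sum (f := fun F : Multiset Y => (F.card : ℝ))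
      (fun _ _ => Nat.cast_nonneg _) hF).trans (by simp [n])
  have hn0 : 0 < n := by positivity
  have hδ : 0 < ε / 2 / n := by positivity
  obtain ⟨κ, hκz, hκ, hκS⟩ := exists_equivariant_family (W := Multiset Z) (π z)
    (fun q => ∀ R ∈ q.support, z ∈ R) (fun T hT δ hδ => by
      obtain ⟨q, h1, h2, h3⟩ := hz z T hT δ hδ
      exact ⟨q, h2, h1, h3⟩) S B hδ
  let η : Y → Multiset Z →₀ ℝ := fun y => if y ∈ orbit G (π z) then κ y else single 0 1
  have hη : ∀ y, IsProb (η y) := fun y => by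
    simp only [η]
    split_ifs
    exacts [hκ y, isProb_single _]
  refine ⟨bind p (convProd η), hp.bind fun F _ => isProb_convProd hη F, fun R hR => ?_,
    fun s hs => ?_⟩
  · obtain ⟨F, hF, hR⟩ := exists_mem_support_of_mem_support_bind hR
    obtain ⟨E, hE, hER⟩ := exists_le_of_mem_support_convProd (hpz F hF) hR
    simp only [η, mem_orbit_self, if_true] at hE
    exact Multiset.mem_of_le hER (hκz E hE)
  · rw [← add_halves ε]
    refine l1_act_bind_sub_le s hp (fun F => (isProb_convProd hη F).l1_le_one) (hpS s hs)
      fun F hF => (l1_act_convProd_sub_le hη s (b := ε / 2 / n) F fun y hy => ?_).trans ?_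
    · have hyB : y ∈ B := Finset.mem_biUnion.2 ⟨F, hF, Multiset.mem_toFinset.2 hy⟩
      by_cases hyo : y ∈ orbit G (π z)
      · simp only [η, if_pos hyo, if_pos (mem_orbit_of_mem_orbit s hyo)]
        exact hκS s hs y hyB hyo
      · have hyo' : s • y ∉ orbit G (π z) := fun h => hyo (by
          simpa using mem_orbit_of_mem_orbit s⁻¹ h)
        simp only [η, if_neg hyo, if_neg hyo']
        simpa using hδ.le
    · calc (F.card : ℝ) * (ε / 2 / n) ≤ n * (ε / 2 / n) := by
            gcongr
            exact hn F hF
        _ = ε / 2 := by field_simp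

/-- A point of an action on whose orbit the group acts through an amenable quotient. -/
theorem exists_of_amen_quotient {Q : Type*} [Group Q] (σ : G →* Q) (hσ : Amen σ.range) (z : Z)
    (hz : ∀ k, σ k = 1 → k • z = z) (S : Finset G) {ε : ℝ} (hε : 0 < ε) :
    ∃ q : Multiset Z →₀ ℝ, IsProb q ∧ (∀ R ∈ q.support, z ∈ R) ∧
      ∀ s ∈ S, l1 (act s q - q) ≤ ε := by
  classical
  obtain ⟨p, hp, hpS⟩ := hσ (S.image σ.rangeRestrict) ε hε
  have hsurj := σ.rangeRestrict_surjective
  let ℓ := Function.surjInv hsurj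
  have hℓ : ∀ γ, σ (ℓ γ) = γ := fun γ => congrArg Subtype.val (Function.surjInv_eq hsurj γ)
  -- The kernel of `σ` is normal, so it fixes the whole orbit of `z`.
  have htriv : ∀ a b c : G, σ a = σ b → a • c • z = b • c • z := by
    intro a b c hab
    have : (c⁻¹ * (b⁻¹ * a) * c) • z = z := hz _ (by simp [hab])
    rw [mul_smul, mul_smul, mul_smul, inv_smul_eq_iff, inv_smul_eq_iff] at this
    exact this
  -- The term with `c = γ` is `z` itself, because `ℓ γ * ℓ γ⁻¹` lies in the kernel of `σ`.
  let θ : σ.range → Multiset Z := fun γ => p.support.val.map fun c => ℓ γ • ℓ c⁻¹ • z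
  refine ⟨mapDomain θ p, hp.mapDomain _, fun R hR => ?_, fun s hs => ?_⟩
  · obtain ⟨γ, hγ, rfl⟩ := Finset.mem_image.1 (mapDomain_support hR)
    refine Multiset.mem_map.2 ⟨γ, hγ, ?_⟩
    rw [← mul_smul]
    exact hz _ (by simp [hℓ])
  · rw [act_mapDomain_hom θ (h := σ.rangeRestrict s), ← mapDomain_sub]
    · exact (l1_mapDomain_le _ _).trans (hpS _ (Finset.mem_image_of_mem _ hs))
    · intro γ
      simp only [θ, smul_multiset, Multiset.map_map]
      refine Multiset.map_congr rfl fun c _ => ?_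
      simp only [Function.comp_apply]
      rw [← mul_smul s]
      exact htriv _ _ _ (by simp [hℓ])

end FinMeasure

/-! ### Recurrent actions are extensively amenable -/

namespace FinMeasure

open Finsupp MulAction

variable {Y : Type*}

/-- The random subset of `{y}` that contains `y` with probability `sin² (θ y)`. -/
noncomputable def bernoulli (θ : Y → ℝ) (y : Y) : Multiset Y →₀ ℝ :=
  single {y} (Real.sin (θ y) ^ 2) + single 0 (Real.cos (θ y) ^ 2)

theorem isProb_bernoulli (θ : Y → ℝ) (y : Y) : IsProb (bernoulli θ y) := by
  classical
  refine isProb_of_nonneg (fun R => ?_) (by simp [bernoulli])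
  rw [bernoulli, Finsupp.add_apply, single_apply, single_apply]
  split_ifs <;> positivity

theorem conv_single_zero (q : Multiset Y →₀ ℝ) : conv (single 0 1) q = q := by
  simp only [conv, bind_single, zero_add, one_smul]
  rw [← mapDomain_eq_bind fun R => R]
  exact mapDomain_id

/-- A point with angle `0` is never chosen, so its factor is the unit of `conv`. -/
theorem convProd_bernoulli_mono {θ : Y → ℝ} {U V : Finset Y} (hVU : V ⊆ U)
    (hV : ∀ y ∉ V, θ y = 0) : convProd (bernoulli θ) U.val = convProd (bernoulli θ) V.val := by
  classical
  obtain ⟨W, hW, rfl⟩ : ∃ W, Disjoint V W ∧ U = V ∪ W :=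
    ⟨U \ V, Finset.disjoint_sdiff, (Finset.union_sdiff_of_subset hVU).symm⟩
  clear hVU
  induction W using Finset.induction_on with
  | empty => simp
  | insert y W hy ih =>
    have hyV : y ∉ V := fun h => (Finset.disjoint_left.1 hW h (Finset.mem_insert_self _ _))
    have hyVW : y ∉ V ∪ W := by simp [hyV, hy]
    rw [Finset.union_insert, Finset.insert_val_of_notMem hyVW, convProd_cons,
      ih (hW.mono_right (Finset.subset_insert _ _))]
    simp [bernoulli, hV y hyV, conv_single_zero]

-- Each set has as its weight the square of a product of sines and cosines. The unsquared products
-- form a unit vector, and comparing such vectors is the point of the parametrization by angles.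
open Classical in
theorem convProd_bernoulli_eq (θ : Y → ℝ) (V : Finset Y) :
    convProd (bernoulli θ) V.val = ∑ A ∈ V.powerset,
      ((∏ y ∈ A, Real.sin (θ y)) * ∏ y ∈ V \ A, Real.cos (θ y)) ^ 2 • single A.val (1 : ℝ) := by
  induction V using Finset.induction_on with
  | empty => simp
  | insert y V hy ih =>
    have h1 : ∀ A ∈ V.powerset, y ∉ A := fun A hA h => hy (Finset.mem_powerset.1 hA h)
    rw [Finset.insert_val_of_notMem hy, convProd_cons, ih, Finset.sum_powerset_insert hy, conv,
      bernoulli, bind, map_add, ← bind, ← bind, bind_single, bind_single, add_comm]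
    have h2 : ∀ E : Multiset Y, ∀ f : Finset Y → ℝ,
        bind (∑ A ∈ V.powerset, f A • single A.val (1 : ℝ)) (fun F => single (E + F) (1 : ℝ)) =
          ∑ A ∈ V.powerset, f A • single (E + A.val) 1 := fun E f => by
      simp [bind, map_sum]
    rw [h2, h2, Finset.smul_sum, Finset.smul_sum]
    congr 1
    · refine Finset.sum_congr rfl fun A hA => ?_
      rw [zero_add, smul_smul, Finset.insert_sdiff_of_notMem _ (h1 A hA),
        Finset.prod_insert (by simp [hy])]
      congr 1
      ring
    · refine Finset.sum_congr rfl fun A hA => ?_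
      rw [smul_smul, Finset.insert_sdiff_insert, Finset.sdiff_insert_of_notMem hy,
        Finset.prod_insert (h1 A hA), Finset.insert_val_of_notMem (h1 A hA),
        Multiset.singleton_add]
      congr 1
      ring

/-- Weierstrass' product inequality. -/
theorem one_sub_sum_le_prod (V : Finset Y) (c : Y → ℝ) (h0 : ∀ y ∈ V, 0 ≤ c y)
    (h1 : ∀ y ∈ V, c y ≤ 1) : 1 - ∑ y ∈ V, (1 - c y) ≤ ∏ y ∈ V, c y ∧ ∏ y ∈ V, c y ≤ 1 := by
  classical
  refine ⟨?_, Finset.prod_le_one h0 h1⟩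
  induction V using Finset.induction_on with
  | empty => simp
  | insert y V hy ih =>
    rw [Finset.sum_insert hy, Finset.prod_insert hy]
    have h2 := ih (fun z hz => h0 z (Finset.mem_insert_of_mem hz))
      fun z hz => h1 z (Finset.mem_insert_of_mem hz)
    have h3 := Finset.prod_le_one (fun z hz => h0 z (Finset.mem_insert_of_mem hz))
      fun z hz => h1 z (Finset.mem_insert_of_mem hz)
    nlinarith [h1 y (Finset.mem_insert_self _ _)]

/-- The distance of two random sets with independent points, by Hellinger's inequality. -/
theorem l1_convProd_bernoulli_sub_sq_le (θ θ' : Y → ℝ) (V : Finset Y)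
    (hθ : ∀ y ∈ V, |θ y - θ' y| ≤ Real.pi / 2) :
    l1 (convProd (bernoulli θ) V.val - convProd (bernoulli θ') V.val) ^ 2 ≤
      4 * ∑ y ∈ V, (θ y - θ' y) ^ 2 := by
  classical
  let ψ : (Y → ℝ) → Finset Y → ℝ := fun θ A =>
    (∏ y ∈ A, Real.sin (θ y)) * ∏ y ∈ V \ A, Real.cos (θ y)
  -- The inner product factorizes: this is the expansion over subsets of the product of the sums cos
  -- cos + sin sin.
  have hψ : ∀ θ θ' : Y → ℝ, ∑ A ∈ V.powerset, ψ θ A * ψ θ' A =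
      ∏ y ∈ V, Real.cos (θ y - θ' y) := fun θ θ' => by
    simp_rw [Real.cos_sub, add_comm (Real.cos _ * Real.cos _)]
    rw [Finset.prod_add]
    refine Finset.sum_congr rfl fun A _ => ?_
    simp only [ψ, Finset.prod_mul_distrib]
    ring
  have hone : ∀ θ, ∑ A ∈ V.powerset, ψ θ A ^ 2 = 1 := fun θ => by
    simpa [sq] using hψ θ θ
  have hle : l1 (convProd (bernoulli θ) V.val - convProd (bernoulli θ') V.val) ≤
      ∑ A ∈ V.powerset, |ψ θ A - ψ θ' A| * |ψ θ A + ψ θ' A| := by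
    rw [convProd_bernoulli_eq, convProd_bernoulli_eq, ← Finset.sum_sub_distrib]
    refine (l1_sum_le _ _).trans (Finset.sum_le_sum fun A _ => ?_)
    rw [← sub_smul, l1_smul, l1_single, abs_one, mul_one, ← abs_mul]
    apply le_of_eq
    congr 1
    simp only [ψ]
    ring
  set c := ∏ y ∈ V, Real.cos (θ y - θ' y) with hc
  have h1 : ∑ A ∈ V.powerset, |ψ θ A - ψ θ' A| ^ 2 = 2 - 2 * c := by
    simp_rw [sq_abs, sub_sq, Finset.sum_add_distrib, Finset.sum_sub_distrib, hone, mul_assoc,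
      ← Finset.mul_sum, hψ]
    ring
  have h2 : ∑ A ∈ V.powerset, |ψ θ A + ψ θ' A| ^ 2 = 2 + 2 * c := by
    simp_rw [sq_abs, add_sq, Finset.sum_add_distrib, hone, mul_assoc,
      ← Finset.mul_sum, hψ]
    ring
  -- Cauchy–Schwarz bounds the square by (2 - 2c)(2 + 2c) ≤ 8(1 - c), and 1 - c is at most half the
  -- sum of the squared angle differences.
  have h3 := Finset.sum_mul_sq_le_sq_mul_sq V.powerset (fun A => |ψ θ A - ψ θ' A|)
    fun A => |ψ θ A + ψ θ' A|
  rw [h1, h2] at h3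
  obtain ⟨h4, h5⟩ := one_sub_sum_le_prod V (fun y => Real.cos (θ y - θ' y))
    (fun y hy => Real.cos_nonneg_of_mem_Icc ⟨by linarith [(abs_le.1 (hθ y hy)).1],
      (abs_le.1 (hθ y hy)).2⟩) fun y _ => Real.cos_le_one _
  have h6 : ∑ y ∈ V, (1 - Real.cos (θ y - θ' y)) ≤ ∑ y ∈ V, (θ y - θ' y) ^ 2 / 2 :=
    Finset.sum_le_sum fun y _ => by linarith [Real.one_sub_sq_div_two_le_cos (x := θ y - θ' y)]
  rw [← Finset.sum_div] at h6
  have h7 := pow_le_pow_left₀ (l1_nonneg _) hle 2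
  rw [← hc] at h4 h5
  nlinarith

variable {G : Type*} [Group G] [MulAction G Y]

theorem act_convProd_bernoulli (s : G) (θ : Y → ℝ) (F : Multiset Y) :
    act s (convProd (bernoulli θ) F) = convProd (bernoulli fun y => θ (s⁻¹ • y)) (s • F) := by
  induction F using Multiset.induction_on with
  | empty => simp
  | cons y F ih =>
    have h : s • (y ::ₘ F) = (s • y) ::ₘ (s • F) := Multiset.map_cons _ _ _
    rw [h, convProd_cons, convProd_cons, act_conv, ih]
    congr 1
    simp [bernoulli, act, mapDomain_add, smul_multiset]

/-- A finitely supported function of small energy with value `1` at `y₀` yields an almost invariant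
random finite set that contains `y₀`. -/
theorem exists_random_set (f : Y → ℝ) (hfin : f.support.Finite) (h0 : ∀ y, 0 ≤ f y)
    (h1 : ∀ y, f y ≤ 1) {y₀ : Y} (hy₀ : f y₀ = 1) :
    ∃ p : Multiset Y →₀ ℝ, IsProb p ∧ (∀ R ∈ p.support, y₀ ∈ R) ∧
      ∀ s : G, l1 (act s p - p) ^ 2 ≤ Real.pi ^ 2 * ∑ᶠ y, (f (s • y) - f y) ^ 2 := by
  classical
  -- The angle π/2 at `y₀` forces `y₀` into the set, and 4 (π/2)² is the constant π² of the bound.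
  let θ : Y → ℝ := fun y => Real.pi / 2 * f y
  have hsin : Real.sin (θ y₀) = 1 := by simp [θ, hy₀]
  have hcos : Real.cos (θ y₀) = 0 := by simp [θ, hy₀]
  refine ⟨convProd (bernoulli θ) hfin.toFinset.val, isProb_convProd (isProb_bernoulli θ) _,
    fun R hR => ?_, fun s => ?_⟩
  · obtain ⟨E, hE, hER⟩ := exists_le_of_mem_support_convProd (y := y₀) (by simp [hy₀]) hR
    rw [bernoulli, hsin, hcos] at hE
    simp only [one_pow, ne_eq, OfNat.ofNat_ne_zero, not_false_eq_true, zero_pow, single_zero,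
      add_zero] at hE
    rw [Finset.mem_singleton.1 (support_single_subset hE)] at hER
    exact Multiset.singleton_le.1 hER
  · let V := hfin.toFinset
    let V' := V.map ⟨fun y => s • y, MulAction.injective s⟩
    have hV : ∀ y ∉ V, θ y = 0 := fun y hy => by
      have : f y = 0 := by simpa [V] using hy
      simp [θ, this]
    have hV' : ∀ y ∉ V', θ (s⁻¹ • y) = 0 := fun y hy => hV _ fun hy' => hy
      (Finset.mem_map.2 ⟨_, hy', by simp⟩)
    have e1 : s • V.val = V'.val := rfl
    rw [act_convProd_bernoulli, e1,
      ← convProd_bernoulli_mono (Finset.subset_union_right : V' ⊆ V ∪ V') hV',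
      ← convProd_bernoulli_mono (Finset.subset_union_left : V ⊆ V ∪ V') hV]
    refine (l1_convProd_bernoulli_sub_sq_le _ _ _ fun y _ => ?_).trans ?_
    · simp only [θ]
      rw [← mul_sub, abs_mul, abs_of_pos (by positivity)]
      have : |f (s⁻¹ • y) - f y| ≤ 1 := abs_sub_le_iff.2
        ⟨by linarith [h0 y, h1 (s⁻¹ • y)], by linarith [h1 y, h0 (s⁻¹ • y)]⟩
      exact mul_le_of_le_one_right (by positivity) this
    · have e2 : ∑ᶠ y, (f (s • y) - f y) ^ 2 = ∑ᶠ y, (f (s⁻¹ • y) - f y) ^ 2 := by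
        rw [← finsum_comp_equiv (MulAction.toPerm s : Equiv.Perm Y)
          (f := fun y => (f (s⁻¹ • y) - f y) ^ 2)]
        refine finsum_congr fun y => ?_
        simp only [MulAction.toPerm_apply, inv_smul_smul]
        ring
      rw [e2, finsum_eq_sum_of_support_subset (s := V ∪ V')]
      · apply le_of_eq
        simp only [θ]
        rw [Finset.mul_sum, Finset.mul_sum]
        refine Finset.sum_congr rfl fun y _ => ?_
        ring
      · intro y hy
        by_contra hne
        simp only [Finset.coe_union, Set.mem_union, Finset.mem_coe, not_or] at hne
        have a1 := hV y hne.1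
        have a2 := hV' y hne.2
        simp only [θ, mul_eq_zero, div_eq_zero_iff, Real.pi_ne_zero, OfNat.ofNat_ne_zero,
          or_self, false_or] at a1 a2
        simp [a1, a2] at hy

/-- It suffices to check extensive amenability for a generating set and one point. -/
theorem extAmen_of_generators [IsPretransitive G Y] (S : Finset G)
    (hS : Subgroup.closure (S : Set G) = ⊤) (y₀ : Y)
    (h : ∀ ε : ℝ, 0 < ε → ∃ p : Multiset Y →₀ ℝ, IsProb p ∧ (∀ R ∈ p.support, y₀ ∈ R) ∧
      ∀ s ∈ S, l1 (act s p - p) ≤ ε) : ExtAmen G Y := by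
  classical
  -- Displacements add up along a word in the generators; `N` is a word length, independent of `p`.
  have hlen : ∀ g : G, ∃ N : ℕ, ∀ (p : Multiset Y →₀ ℝ) (ε : ℝ),
      (∀ s ∈ S, l1 (act s p - p) ≤ ε) → l1 (act g p - p) ≤ N * ε := by
    intro g
    have hg : g ∈ Subgroup.closure (S : Set G) := hS ▸ Subgroup.mem_top g
    induction hg using Subgroup.closure_induction with
    | mem s hs => exact ⟨1, fun p ε hp => by simpa using hp s hs⟩
    | one => exact ⟨0, fun p ε hp => by simp⟩
    | mul a b _ _ iha ihb =>
      obtain ⟨m, hm⟩ := iha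
      obtain ⟨n, hn⟩ := ihb
      refine ⟨m + n, fun p ε hp => ?_⟩
      have e : act (a * b) p - act a p = act a (act b p - p) := by rw [act_mul, act_sub]
      refine (l1_sub_le _ (act a p) _).trans ?_
      rw [e]
      push_cast
      linarith [l1_act_le a (act b p - p), hm p ε hp, hn p ε hp]
    | inv a _ iha =>
      obtain ⟨m, hm⟩ := iha
      refine ⟨m, fun p ε hp => ?_⟩
      have e : act a⁻¹ p - p = act a⁻¹ (p - act a p) := by
        rw [act_sub, ← act_mul, inv_mul_cancel, act_one]
      rw [e]
      refine (l1_act_le _ _).trans ?_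
      rw [l1_sub_comm]
      exact hm p ε hp
  choose N hN using hlen
  intro y T ε hε
  obtain ⟨g, rfl⟩ := exists_smul_eq G y₀ y
  -- The measure for `g • y₀` is the translate of `p` by `g`, which `t` displaces no more than `g⁻¹
  -- * t * g` displaces `p`.
  let M : ℝ := ∑ t ∈ T, (N (g⁻¹ * t * g) : ℝ) + 1
  have hM : 0 < M := by positivity
  obtain ⟨p, hp, hpy, hpS⟩ := h (ε / M) (by positivity)
  refine ⟨act g p, hp.act g, fun R hR => ?_, fun t ht => ?_⟩
  · obtain ⟨R', hR', rfl⟩ := mem_support_act hR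
    exact smul_mem_smul_multiset (hpy R' hR')
  · have e : act t (act g p) - act g p = act g (act (g⁻¹ * t * g) p - p) := by
      rw [act_sub, ← act_mul, ← act_mul]
      congr 2
      group
    rw [e]
    refine (l1_act_le _ _).trans ((hN _ p _ hpS).trans ?_)
    have : (N (g⁻¹ * t * g) : ℝ) ≤ M :=
      (Finset.single_le_sum (f := fun t => (N (g⁻¹ * t * g) : ℝ))
        (fun _ _ => Nat.cast_nonneg _) ht).trans (by simp [M])
    calc (N (g⁻¹ * t * g) : ℝ) * (ε / M) ≤ M * (ε / M) := by gcongr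
      _ = ε := by field_simp

end FinMeasure

/-! ### Hitting probabilities and their energy. -/

namespace RootedTree

open MulAction FinMeasure

section Recurrent

variable {G Y : Type*} [Group G] [MulAction G Y]

open Classical in
/-- The probability that the walk started at `y` is at `y₀` at one of the times `0, …, n`. -/
noncomputable def hitProb (S : Finset G) (y₀ : Y) (n : ℕ) (y : Y) : ℝ :=
  if y = y₀ then 1 else visitProb S y₀ n y

theorem visitProb_succ (S : Finset G) (y₀ : Y) (n : ℕ) (y : Y) :
    visitProb S y₀ (n + 1) y = (∑ s ∈ S, hitProb S y₀ n (s • y)) / (S.card : ℝ) := rfl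

theorem hitProb_self (S : Finset G) (y₀ : Y) (n : ℕ) : hitProb S y₀ n y₀ = 1 := by
  simp [hitProb]

theorem visitProb_mem_Icc (S : Finset G) (y₀ : Y) (n : ℕ) (y : Y) :
    0 ≤ visitProb S y₀ n y ∧ visitProb S y₀ n y ≤ 1 ∧
      visitProb S y₀ n y ≤ visitProb S y₀ (n + 1) y := by
  have hit : ∀ n, (∀ y, 0 ≤ visitProb S y₀ n y ∧ visitProb S y₀ n y ≤ 1) →
      ∀ y, 0 ≤ hitProb S y₀ n y ∧ hitProb S y₀ n y ≤ 1 := by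
    intro n h y
    rw [hitProb]
    split_ifs
    exacts [⟨zero_le_one, le_rfl⟩, h y]
  have bd : ∀ n, ∀ y, 0 ≤ visitProb S y₀ n y ∧ visitProb S y₀ n y ≤ 1 := by
    intro n
    induction n with
    | zero => simp [visitProb]
    | succ n ih =>
      intro y
      rw [visitProb_succ]
      refine ⟨div_nonneg (Finset.sum_nonneg fun s _ => (hit n ih _).1) (Nat.cast_nonneg _),
        div_le_one_of_le₀ ?_ (Nat.cast_nonneg _)⟩
      exact (Finset.sum_le_sum fun s _ => (hit n ih (s • y)).2).trans (by simp)
  refine ⟨(bd n y).1, (bd n y).2, ?_⟩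
  induction n generalizing y with
  | zero => exact (bd 1 y).1
  | succ n ih =>
    rw [visitProb_succ, visitProb_succ S y₀ (n + 1)]
    refine div_le_div_of_nonneg_right (Finset.sum_le_sum fun s _ => ?_) (Nat.cast_nonneg _)
    rw [hitProb, hitProb]
    split_ifs
    exacts [le_rfl, ih _]

theorem hitProb_mem_Icc (S : Finset G) (y₀ : Y) (n : ℕ) (y : Y) :
    0 ≤ hitProb S y₀ n y ∧ hitProb S y₀ n y ≤ 1 := by
  rw [hitProb]
  split_ifs
  exacts [⟨zero_le_one, le_rfl⟩, ⟨(visitProb_mem_Icc S y₀ n y).1, (visitProb_mem_Icc S y₀ n y).2.1⟩]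

theorem finite_support_hitProb (S : Finset G) (y₀ : Y) (n : ℕ) :
    (Function.support (hitProb S y₀ n)).Finite := by
  have hle : ∀ n, Function.support (hitProb S y₀ n) ⊆
      {y₀} ∪ Function.support (visitProb S y₀ n) := by
    intro n y hy
    by_cases h : y = y₀
    · exact Or.inl h
    · exact Or.inr (by simpa [hitProb, h] using hy)
  suffices h : (Function.support (visitProb S y₀ n)).Finite from
    ((Set.finite_singleton _).union h).subset (hle n)
  induction n with
  | zero => simp [Function.support, visitProb]
  | succ n ih =>
    have hf := ((Set.finite_singleton _).union ih).subset (hle n)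
    refine (S.finite_toSet.biUnion fun s _ => hf.preimage
      (f := fun y => s • y) (MulAction.injective s).injOn).subset ?_
    intro y hy
    by_contra hne
    simp only [SetLike.mem_coe, Set.mem_iUnion, Set.mem_preimage, Function.mem_support, not_exists,
      not_not] at hne
    refine hy ?_
    rw [visitProb_succ, Finset.sum_eq_zero fun s hs => hne s hs, zero_div]

/-- Summation by parts: every `s` permutes `Y`, so the energy is `2 * S.card` times the sum of f (f
- Pf), where Pf is the one-step average of f, that is, `visitProb` at time `n + 1`. Off `y₀` the
function f is `visitProb` at time `n`, which increases with `n`, so those terms are at most `0` and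
only `y₀` counts. -/
theorem sum_energy_hitProb_le (S : Finset G) (hS : S.Nonempty) (y₀ : Y) (n : ℕ) :
    ∑ s ∈ S, ∑ᶠ y, (hitProb S y₀ n (s • y) - hitProb S y₀ n y) ^ 2 ≤
      2 * S.card * (1 - visitProb S y₀ (n + 1) y₀) := by
  set f := hitProb S y₀ n with hf
  have hfin := finite_support_hitProb S y₀ n
  have hcard : (S.card : ℝ) ≠ 0 := by exact_mod_cast hS.card_ne_zero
  have hfs : ∀ s : G, (Function.support fun y => f (s • y)).Finite := fun s =>
    hfin.preimage (f := fun y => s • y) (MulAction.injective s).injOn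
  have hsq : (Function.support fun y => f y ^ 2).Finite :=
    hfin.subset fun y hy => by simpa using hy
  have hmul : ∀ s : G, (Function.support fun y => f y * f (s • y)).Finite := fun s =>
    hfin.subset fun y hy => by simp at hy; exact hy.1
  have h1 : ∀ s : G, ∑ᶠ y, (f (s • y) - f y) ^ 2 =
      2 * ∑ᶠ y, f y ^ 2 - 2 * ∑ᶠ y, f y * f (s • y) := by
    intro s
    have e1 : ∑ᶠ y, f (s • y) ^ 2 = ∑ᶠ y, f y ^ 2 :=
      finsum_comp_equiv (MulAction.toPerm s : Equiv.Perm Y) (f := fun y => f y ^ 2)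
    have hs2 : (Function.support fun y => f (s • y) ^ 2).Finite :=
      (hfs s).subset fun y hy => by simpa using hy
    have e2 : ∑ᶠ y, (f (s • y) - f y) ^ 2 =
        ∑ᶠ y, f (s • y) ^ 2 + ∑ᶠ y, f y ^ 2 - ∑ᶠ y, 2 * (f y * f (s • y)) := by
      rw [← finsum_add_distrib hs2 hsq, ← finsum_sub_distrib]
      · exact finsum_congr fun y => by ring
      · exact (hs2.union hsq).subset (Function.support_add _ _)
      · exact (hmul s).subset fun y hy => by simpa using hy
    rw [e2, e1, ← mul_finsum' _ _ (hmul s)]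
    ring
  have h2 : ∑ᶠ y, ∑ s ∈ S, f y * f (s • y) = ∑ s ∈ S, ∑ᶠ y, f y * f (s • y) :=
    finsum_sum_comm S _ fun s _ => hmul s
  simp_rw [h1]
  rw [Finset.sum_sub_distrib, ← Finset.mul_sum, ← Finset.mul_sum, ← h2, Finset.sum_const,
    nsmul_eq_mul]
  have h3 : ∀ y, ∑ s ∈ S, f y * f (s • y) = S.card * (f y * visitProb S y₀ (n + 1) y) := by
    intro y
    rw [visitProb_succ, ← Finset.mul_sum]
    field_simp
    rfl
  have hfu : (Function.support fun y => f y * visitProb S y₀ (n + 1) y).Finite :=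
    hfin.subset fun y hy => by simp at hy; exact hy.1
  simp_rw [h3]
  rw [← mul_finsum' _ _ hfu]
  have h4 : ∑ᶠ y, f y ^ 2 - ∑ᶠ y, f y * visitProb S y₀ (n + 1) y ≤
      1 - visitProb S y₀ (n + 1) y₀ := by
    rw [← finsum_sub_distrib hsq hfu]
    classical
    have e : 1 - visitProb S y₀ (n + 1) y₀ =
        ∑ᶠ y, if y = y₀ then 1 - visitProb S y₀ (n + 1) y₀ else 0 := by
      rw [finsum_eq_single _ y₀ (by simp +contextual)]
      simp
    rw [e]
    refine finsum_le_finsum' ?_ ?_ fun y => ?_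
    · exact (hsq.union hfu).subset (Function.support_sub _ _)
    · exact (Set.finite_singleton y₀).subset fun y hy => by
        by_contra hne
        simp [show y ≠ y₀ from hne] at hy
    · simp only
      split_ifs with hy
      · subst hy
        simp [hf, hitProb_self]
      · have e1 : f y = visitProb S y₀ n y := by simp [hf, hitProb, hy]
        have := visitProb_mem_Icc S y₀ n y
        rw [e1]
        nlinarith
  nlinarith [mul_le_mul_of_nonneg_left h4 (by positivity : (0 : ℝ) ≤ 2 * S.card)]

/-- Recurrent actions are extensively amenable. -/
theorem IsRecurrentAction.extAmen [IsPretransitive G Y] (h : IsRecurrentAction G Y) :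
    ExtAmen G Y := by
  obtain ⟨S, -, hS, y₀, hlim⟩ := h
  -- For empty `S` the quotient by the cardinality is `0`, so the limit could not be `1`.
  have hne : S.Nonempty := by
    rw [Finset.nonempty_iff_ne_empty]
    rintro rfl
    have h0 : ∀ n, visitProb (∅ : Finset G) y₀ n y₀ = 0 := fun n => by
      cases n <;> simp [visitProb]
    simp only [h0] at hlim
    exact zero_ne_one (tendsto_nhds_unique tendsto_const_nhds hlim)
  refine extAmen_of_generators S hS y₀ fun ε hε => ?_
  have hlim' : Filter.Tendsto (fun n => Real.pi ^ 2 * (2 * S.card *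
      (1 - visitProb S y₀ (n + 1) y₀))) Filter.atTop (nhds 0) := by
    have := ((hlim.comp (Filter.tendsto_add_atTop_nat 1)).const_sub 1).const_mul
      (2 * (S.card : ℝ)) |>.const_mul (Real.pi ^ 2)
    simpa using this
  obtain ⟨n, hn⟩ := (hlim'.eventually (gt_mem_nhds (pow_pos hε 2))).exists
  obtain ⟨p, hp, hpy, hpS⟩ := exists_random_set (G := G) (hitProb S y₀ n)
    (finite_support_hitProb S y₀ n) (fun y => (hitProb_mem_Icc S y₀ n y).1)
    (fun y => (hitProb_mem_Icc S y₀ n y).2) (hitProb_self S y₀ n)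
  refine ⟨p, hp, hpy, fun s hs => ?_⟩
  refine le_of_sq_le_sq ((hpS s).trans (le_trans ?_ hn.le)) hε.le
  refine mul_le_mul_of_nonneg_left ?_ (by positivity)
  refine le_trans ?_ (sum_energy_hitProb_le S hne y₀ n)
  exact Finset.single_le_sum
    (f := fun s => ∑ᶠ y, (hitProb S y₀ n (s • y) - hitProb S y₀ n y) ^ 2)
    (fun s _ => finsum_nonneg fun y => sq_nonneg _) hs

end Recurrent

end RootedTree

/-! ### Sections and infinite words -/

namespace RootedTree

variable {X : Type*}

namespace TreeAut

@[simp] theorem sect_nil (g : TreeAut X) : g.sect [] = g := by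
  ext1 w
  have h := apply_append_sect g [] w
  have h0 : g [] = [] := List.length_eq_zero_iff.1 (by simp)
  rw [h0] at h
  simpa using h.symm

theorem sect_append (g : TreeAut X) (u v : List X) : g.sect (u ++ v) = (g.sect u).sect v := by
  ext1 w
  have h1 := apply_append_sect g (u ++ v) w
  rw [List.append_assoc, apply_append_sect g u, apply_append_sect (g.sect u) v,
    apply_append_sect g u, List.append_assoc] at h1
  exact (List.append_cancel_left (List.append_cancel_left h1)).symm

theorem IsFiniteState.sect {g : TreeAut X} (hg : g.IsFiniteState) (v : List X) :
    (g.sect v).IsFiniteState := by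
  refine Set.Finite.subset hg ?_
  rintro _ ⟨u, rfl⟩
  exact ⟨v ++ u, sect_append g v u⟩

end TreeAut

namespace Boundary

theorem pre_succ (w : Boundary X) (n : ℕ) : w.pre (n + 1) = w.pre n ++ [w n] := by
  simp [pre, List.ofFn_succ_last, -List.ofFn_succ]

theorem ext_pre {w w' : Boundary X} (h : ∀ n, w.pre n = w'.pre n) : w = w' := by
  funext n
  have := h (n + 1)
  rw [pre_succ, pre_succ, h n] at this
  simpa using this

/-- The infinite word `u w`. -/
def cat (u : List X) (w : Boundary X) : Boundary X := fun n =>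
  if h : n < u.length then u[n] else w (n - u.length)

theorem pre_cat (u : List X) (w : Boundary X) (n : ℕ) :
    (cat u w).pre (u.length + n) = u ++ w.pre n := by
  apply List.ext_getElem (by simp)
  intro i h1 h2
  simp only [pre, List.getElem_ofFn, cat, List.getElem_append]

theorem pre_cat_length (u : List X) (w : Boundary X) : (cat u w).pre u.length = u := by
  simpa [pre] using pre_cat u w 0

/-- The infinite word obtained by deleting the first `k` letters. -/
def tail (k : ℕ) (w : Boundary X) : Boundary X := fun n => w (k + n)

theorem tail_cat (u : List X) (w : Boundary X) : tail u.length (cat u w) = w := by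
  funext n
  simp [tail, cat]

theorem cat_pre_tail (k : ℕ) (w : Boundary X) : cat (w.pre k) (tail k w) = w := by
  funext n
  simp only [cat, length_pre, tail]
  split_ifs with h
  · simp [pre]
  · rw [Nat.add_sub_cancel' (not_lt.1 h)]

theorem cat_injective (u : List X) : Function.Injective (cat u) := fun w w' h => by
  rw [← tail_cat u w, h, tail_cat]

theorem smul_cat (g : TreeAut X) (u : List X) (w : Boundary X) :
    g • cat u w = cat (g u) (g.sect u • w) := by
  have h : ∀ n, (g • cat u w).pre (u.length + n) =
      (cat (g u) (g.sect u • w)).pre (u.length + n) := fun n => by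
    conv_rhs => rw [← TreeAut.length_apply g u]
    rw [pre_cat, pre_smul, pre_smul, pre_cat, TreeAut.apply_append_sect]
  refine ext_pre fun n => ?_
  have h1 := pre_prefix (g • cat u w) (Nat.le_add_left n u.length)
  have h2 := pre_prefix (cat (g u) (g.sect u • w)) (Nat.le_add_left n u.length)
  rw [h n] at h1
  exact List.IsPrefix.eq_of_length (List.prefix_of_prefix_length_le h1 h2 (by simp)) (by simp)

theorem exists_pre_eq_append (w : Boundary X) {m n : ℕ} (h : m ≤ n) :
    ∃ v : List X, v.length = n - m ∧ w.pre n = w.pre m ++ v := by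
  obtain ⟨v, hv⟩ := w.pre_prefix h
  refine ⟨v, ?_, hv.symm⟩
  have := congrArg List.length hv
  simp at this
  omega

/-- Following a property of sections down the tree. -/
theorem exists_path {P : TreeAut X → Prop} (hP : ∀ g, P g → ∃ x : X, P (g.sect [x]))
    {g : TreeAut X} (hg : P g) : ∃ w : Boundary X, ∀ n, P (g.sect (w.pre n)) := by
  choose x hx using hP
  let st : ℕ → {g // P g} := fun n => Nat.rec ⟨g, hg⟩ (fun _ h => ⟨_, hx h.1 h.2⟩) n
  let w : Boundary X := fun n => x (st n).1 (st n).2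
  have h : ∀ n, g.sect (w.pre n) = (st n).1 := by
    intro n
    induction n with
    | zero => simp [pre, st]
    | succ n ih => rw [pre_succ, TreeAut.sect_append, ih]
  exact ⟨w, fun n => by rw [h]; exact (st n).2⟩

end Boundary

/-! ### The degree of an automorphism -/

open Boundary TreeAut

/-- `Deg 0` is the class of finitary automorphisms, and `Deg (e + 1)` consists of the automorphisms
that are in `Deg e` near all but finitely many points of the boundary. -/
def Deg : ℕ → TreeAut X → Prop
  | 0, g => ∃ n, ∀ v : List X, v.length = n → g.sect v = 1
  | e + 1, g => {w : Boundary X | ∀ n, ¬ Deg e (g.sect (w.pre n))}.Finite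

theorem sect_eq_one_of_le {g : TreeAut X} {n : ℕ} (h : ∀ v : List X, v.length = n → g.sect v = 1)
    {v : List X} (hv : n ≤ v.length) : g.sect v = 1 := by
  rw [← List.take_append_drop n v, sect_append, h _ (by simpa using hv), one_sect]

theorem Deg.sect {e : ℕ} {g : TreeAut X} (hg : Deg e g) (v : List X) : Deg e (g.sect v) := by
  induction e generalizing g v with
  | zero =>
    obtain ⟨n, hn⟩ := hg
    refine ⟨n, fun u hu => ?_⟩
    rw [← sect_append]
    exact sect_eq_one_of_le hn (by simp [hu])
  | succ e ih =>
    refine Set.Finite.subset (Set.Finite.preimage (cat_injective v).injOn hg) ?_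
    intro w hw n hn
    refine hw n ?_
    rw [← sect_append, ← pre_cat]
    obtain ⟨u, -, hu⟩ := exists_pre_eq_append (cat v w) (Nat.le_add_left n v.length)
    rw [hu, sect_append]
    exact ih hn u

theorem Deg.sect_pre_of_le {e : ℕ} {g : TreeAut X} {w : Boundary X} {m n : ℕ}
    (h : Deg e (g.sect (w.pre m))) (hmn : m ≤ n) : Deg e (g.sect (w.pre n)) := by
  obtain ⟨u, -, hu⟩ := exists_pre_eq_append w hmn
  rw [hu, sect_append]
  exact h.sect u

theorem deg_one (e : ℕ) : Deg e (1 : TreeAut X) := by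
  induction e with
  | zero => exact ⟨0, fun v _ => one_sect v⟩
  | succ e ih =>
    refine Set.Finite.subset Set.finite_empty fun w hw => hw 0 ?_
    rwa [one_sect]

theorem Deg.mul {e : ℕ} {g h : TreeAut X} (hg : Deg e g) (hh : Deg e h) : Deg e (g * h) := by
  induction e generalizing g h with
  | zero =>
    obtain ⟨m, hm⟩ := hg
    obtain ⟨n, hn⟩ := hh
    refine ⟨max m n, fun v hv => ?_⟩
    rw [mul_sect, sect_eq_one_of_le hm (by simp [hv]), sect_eq_one_of_le hn (by simp [hv]), one_mul]
  | succ e ih =>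
    refine Set.Finite.subset (Set.Finite.union hh
      (Set.Finite.preimage (MulAction.injective h).injOn hg)) ?_
    intro w hw
    by_contra hne
    simp only [Set.mem_union, Set.mem_preimage, Set.mem_ofPred_eq, not_or, not_forall,
      not_not] at hne
    obtain ⟨⟨m, hm⟩, n, hn⟩ := hne
    refine hw (max m n) ?_
    rw [mul_sect, ← pre_smul]
    exact ih (hn.sect_pre_of_le (le_max_right _ _)) (hm.sect_pre_of_le (le_max_left _ _))

theorem Deg.inv {e : ℕ} {g : TreeAut X} (hg : Deg e g) : Deg e g⁻¹ := by
  induction e generalizing g with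
  | zero =>
    obtain ⟨n, hn⟩ := hg
    exact ⟨n, fun v hv => by rw [inv_sect, hn _ ((length_apply g⁻¹ v).trans hv), inv_one]⟩
  | succ e ih =>
    refine Set.Finite.subset (Set.Finite.preimage (MulAction.injective g⁻¹).injOn hg) ?_
    intro w hw n hn
    refine hw n ?_
    rw [inv_sect, ← pre_smul]
    exact ih hn

theorem Deg.of_children [Finite X] {e : ℕ} {g : TreeAut X} (h : ∀ x : X, Deg e (g.sect [x])) :
    Deg e g := by
  cases e with
  | zero =>
    choose n hn using h
    have := Fintype.ofFinite X
    refine ⟨∑ x, n x + 1, fun v hv => ?_⟩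
    cases v with
    | nil => simp at hv
    | cons x v =>
      rw [← List.singleton_append, sect_append]
      refine sect_eq_one_of_le (hn x) ?_
      have h1 := Finset.single_le_sum (f := n) (fun _ _ => Nat.zero_le _) (Finset.mem_univ x)
      have h2 : v.length = ∑ x, n x := by simpa using hv
      exact h2 ▸ h1
  | succ e =>
    refine Set.Finite.subset (Set.finite_iUnion fun x => Set.Finite.image (cat [x]) (h x)) ?_
    intro w hw
    refine Set.mem_iUnion.2 ⟨w 0, tail 1 w, fun n hn => hw (1 + n) ?_, ?_⟩
    · have h1 : w = cat [w 0] (tail 1 w) := by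
        conv_lhs => rw [← cat_pre_tail 1 w]
        simp [pre]
      rw [h1, show 1 + n = [w 0].length + n from rfl, pre_cat, sect_append]
      exact hn
    · conv_rhs => rw [← cat_pre_tail 1 w]
      simp [pre]

/-- König's argument: by `Deg.of_children` the failure persists at some letter. Equivalently, degree
`e` near every boundary point gives degree `e` globally. -/
theorem exists_path_not_deg [Finite X] {e : ℕ} {g : TreeAut X} (h : ¬ Deg e g) :
    ∃ w : Boundary X, ∀ n, ¬ Deg e (g.sect (w.pre n)) :=
  exists_path (P := fun g => ¬ Deg e g) (fun g hg => by
    by_contra hne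
    push Not at hne
    exact hg (.of_children hne)) h

/-- The sections off a cycle have smaller degree. -/
theorem Deg.sect_off_cycle [Finite X] {e : ℕ} {h : TreeAut X} (hd : Deg (e + 1) h) {v x : List X}
    (hv : h.sect v = h) (hx : x.length = v.length) (hne : x ≠ v) : Deg e (h.sect x) := by
  by_contra hdx
  obtain ⟨w, hw⟩ := exists_path_not_deg hdx
  have hcat : ∀ (u : List X) (w : Boundary X), (∀ n, ¬ Deg e ((h.sect u).sect (w.pre n))) →
      ∀ n, ¬ Deg e (h.sect ((cat u w).pre n)) := by
    intro u w hw n hn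
    refine hw n ?_
    rw [← sect_append, ← pre_cat]
    exact hn.sect_pre_of_le (Nat.le_add_left _ _)
  -- The words `v ^ j x w` are pairwise distinct because `x` and `v` are different words of equal
  -- length, and by `h.sect v = h` all of them are points where `h` is not of degree `e`.
  let c : ℕ → Boundary X := fun j => (cat v)^[j] (cat x w)
  have hc : ∀ j, ∀ n, ¬ Deg e (h.sect ((c j).pre n)) := by
    intro j
    induction j with
    | zero => exact hcat x w hw
    | succ j ih =>
      simp only [c, Function.iterate_succ_apply']
      exact hcat v _ (by rwa [hv])
  have h0 : ∀ k, c 0 ≠ c (k + 1) := by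
    intro k hk
    have h1 : (c 0).pre v.length = x := by rw [← hx]; exact pre_cat_length x w
    have h2 : (c (k + 1)).pre v.length = v := by
      simp only [c, Function.iterate_succ_apply']
      exact pre_cat_length v _
    exact hne (by rw [← h1, hk, h2])
  have hinj : Function.Injective c := by
    intro j
    induction j with
    | zero =>
      intro k hk
      cases k with
      | zero => rfl
      | succ k => exact (h0 k hk).elim
    | succ j ih =>
      intro k hk
      cases k with
      | zero => exact (h0 j hk.symm).elim
      | succ k =>
        simp only [c, Function.iterate_succ_apply'] at hk
        rw [ih (cat_injective v hk)]
  exact Set.infinite_of_injective_forall_mem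
    (s := {w : Boundary X | ∀ n, ¬ Deg e (h.sect (w.pre n))}) hinj hc hd

/-! ### The degree and the activity -/

theorem activity_sect_le [Finite X] (g : TreeAut X) (u : List X) (n : ℕ) :
    (g.sect u).activity n ≤ g.activity (u.length + n) := by
  rw [activity, activity, ← Set.ncard_image_of_injective _ (List.append_right_injective u)]
  refine Set.ncard_le_ncard ?_ (finite_active _ _)
  rintro _ ⟨v, ⟨hv, hne⟩, rfl⟩
  exact ⟨by simp [hv], by rwa [sect_append]⟩

/-- The two terms on the left count the active words beginning with `v` and with `x`. -/
theorem activity_add_le [Finite X] {h : TreeAut X} {v x : List X} (hv : h.sect v = h)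
    (hx : x.length = v.length) (hne : x ≠ v) (n : ℕ) :
    h.activity n + (h.sect x).activity n ≤ h.activity (v.length + n) := by
  rw [activity, activity, activity,
    ← Set.ncard_image_of_injective _ (List.append_right_injective v),
    ← Set.ncard_image_of_injective {u : List X | u.length = n ∧ (h.sect x).sect u ≠ 1}
      (List.append_right_injective x),
    ← Set.ncard_union_eq ?_ ((finite_active _ _).image _) ((finite_active _ _).image _)]
  · refine Set.ncard_le_ncard ?_ (finite_active _ _)
    rintro _ (⟨u, ⟨hu, hu'⟩, rfl⟩ | ⟨u, ⟨hu, hu'⟩, rfl⟩)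
    · exact ⟨by simp [hu], by rwa [sect_append, hv]⟩
    · exact ⟨by simp [hu, hx], by rwa [sect_append]⟩
  · rw [Set.disjoint_left]
    rintro _ ⟨u, -, rfl⟩ ⟨u', -, h'⟩
    exact hne (List.append_inj_left h' hx)

/-- Cut `y` into blocks of length `v.length`. Before the first block different from `v` the section
is still `h`, and `hP` discards the blocks after it. -/
theorem exists_off_cycle {P : TreeAut X → Prop} (hP : ∀ g u, P (g.sect u) → P g)
    {h : TreeAut X} {v : List X} (hv : h.sect v = h) (k : ℕ) (y : List X)
    (hy : y.length = k * v.length) (hne : y ≠ (List.replicate k v).flatten) (hPy : P (h.sect y)) :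
    ∃ x : List X, x.length = v.length ∧ x ≠ v ∧ P (h.sect x) := by
  induction k generalizing y with
  | zero => simp at hy; exact (hne (by simp [hy])).elim
  | succ k ih =>
    have hlen : (y.take v.length).length = v.length := by
      rw [List.length_take, hy]
      exact min_eq_left (Nat.le_mul_of_pos_left _ k.succ_pos)
    rw [← List.take_append_drop v.length y, sect_append] at hPy
    by_cases hx : y.take v.length = v
    · rw [hx, hv] at hPy
      refine ih (y.drop v.length) (by rw [List.length_drop, hy, Nat.succ_mul]; omega) ?_ hPy
      intro h'
      refine hne ?_
      rw [← List.take_append_drop v.length y, hx, h']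
      simp [List.replicate_succ]
    · exact ⟨_, hlen, hx, hP _ _ hPy⟩

/-- A finite-state automorphism that is not in `Deg e` has activity at least of the order
`n ^ e`. -/
theorem choose_le_activity [Finite X] {e : ℕ} {g : TreeAut X} (hg : g.IsFiniteState)
    (hd : ¬ Deg e g) : ∃ ℓ m : ℕ, ∀ k n, m + k * ℓ ≤ n → k.choose e ≤ g.activity n := by
  induction e generalizing g with
  | zero =>
    refine ⟨0, 0, fun k n _ => ?_⟩
    rw [Nat.choose_zero_right, activity, Nat.one_le_iff_ne_zero, ← Nat.pos_iff_ne_zero,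
      Set.ncard_pos (finite_active _ _)]
    by_contra hne
    rw [Set.not_nonempty_iff_eq_empty, Set.eq_empty_iff_forall_notMem] at hne
    exact hd ⟨n, fun v hv => by
      by_contra h1
      exact hne v ⟨hv, h1⟩⟩
  | succ e ih =>
    obtain ⟨w, hw⟩ := exists_path_not_deg hd
    -- Along a path of failing sections some state recurs, which yields a cycle `v` of the state
    -- `h`.
    obtain ⟨i, j, hij, hs⟩ := Set.Finite.exists_lt_map_eq_of_forall_mem
      (f := fun n => g.sect (w.pre n)) (t := Set.range g.sect) (fun n => ⟨_, rfl⟩) hg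
    obtain ⟨v, hvl, hv⟩ := exists_pre_eq_append w hij.le
    rw [hv, sect_append] at hs
    set h := g.sect (w.pre i) with hh
    have hhs : h.sect v = h := hs.symm
    have hvpos : 0 < v.length := by omega
    -- `h` has infinitely many bad points; of two distinct ones, at least one is not the periodic
    -- word of `v` and so leaves the cycle.
    obtain ⟨w₁, hw₁, w₂, hw₂, hne⟩ := (Set.Infinite.nontrivial (hw i) : Set.Nontrivial _)
    obtain ⟨x, hxl, hxv, hx⟩ : ∃ x : List X, x.length = v.length ∧ x ≠ v ∧ ¬ Deg e (h.sect x) := by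
      obtain ⟨a, ha⟩ := Function.ne_iff.1 hne
      have hlt : a + 1 ≤ (a + 1) * v.length := Nat.le_mul_of_pos_right _ hvpos
      have hpre : w₁.pre ((a + 1) * v.length) ≠ w₂.pre ((a + 1) * v.length) := by
        intro h'
        have h1 := pre_prefix w₁ hlt
        have h2 := pre_prefix w₂ hlt
        rw [← h'] at h2
        have h3 := List.IsPrefix.eq_of_length
          (List.prefix_of_prefix_length_le h1 h2 (by simp)) (by simp)
        rw [pre_succ, pre_succ] at h3
        exact ha (by simpa using List.append_inj_right h3 (by simp))
      have hP : ∀ (g : TreeAut X) u, ¬ Deg e (g.sect u) → ¬ Deg e g := fun g u h1 h2 =>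
        h1 (h2.sect u)
      by_cases h1 : w₁.pre ((a + 1) * v.length) = (List.replicate (a + 1) v).flatten
      · exact exists_off_cycle (P := fun g => ¬ Deg e g) hP hhs (a + 1) _ (by simp)
          (fun h2 => hpre (h1.trans h2.symm)) (hw₂ _)
      · exact exists_off_cycle (P := fun g => ¬ Deg e g) hP hhs (a + 1) _ (by simp) h1 (hw₁ _)
    obtain ⟨ℓ, m, hm⟩ := ih ((hg.sect _).sect x) hx
    -- Pascal's rule matches the recursion of `activity_add_le`; the maximum serves both the cycle
    -- and the inductive bound.
    have key : ∀ k n, m + k * (max v.length ℓ) ≤ n → k.choose (e + 1) ≤ h.activity n := by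
      intro k
      induction k with
      | zero => simp
      | succ k ihk =>
        intro n hn
        rw [Nat.succ_mul] at hn
        have h1 : v.length ≤ max v.length ℓ := le_max_left _ _
        obtain ⟨n, rfl⟩ : ∃ n', n = v.length + n' := ⟨n - v.length, by omega⟩
        refine le_trans ?_ (activity_add_le hhs hxl hxv n)
        rw [Nat.choose_succ_succ, add_comm]
        have h2 : k * ℓ ≤ k * max v.length ℓ := Nat.mul_le_mul_left _ (le_max_right _ _)
        exact add_le_add (ihk n (by omega)) (hm k n (by omega))
    refine ⟨max v.length ℓ, i + m, fun k n hn => ?_⟩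
    obtain ⟨n, rfl⟩ : ∃ n', n = (w.pre i).length + n' := ⟨n - i, by simp; omega⟩
    refine le_trans (key k n ?_) (activity_sect_le g (w.pre i) n)
    simp at hn
    omega

theorem deg_of_mem_polyActivity [Finite X] {d : ℕ} {g : TreeAut X} (hg : g ∈ polyActivity X d) :
    Deg (d + 1) g := by
  obtain ⟨hfs, p, hp, hact⟩ := hg
  by_contra hd
  obtain ⟨ℓ, m, hm⟩ := choose_le_activity hfs hd
  -- For `k = j + d` the binomial coefficient is at least `j ^ (d + 1) / (d + 1)!`, so the activity
  -- bound at `m + (j + d) * ℓ` would give `j ^ (d + 1) ≤ q.eval j`, although `q` has degree at most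
  -- `d`.
  let q : Polynomial ℝ := Polynomial.C ((d + 1).factorial : ℝ) *
    p.comp (Polynomial.C (ℓ : ℝ) * Polynomial.X + Polynomial.C (m + d * ℓ : ℝ))
  have hq : q.degree ≤ (d : ℕ) := by
    refine Polynomial.natDegree_le_iff_degree_le.1 ?_
    refine (Polynomial.natDegree_C_mul_le _ _).trans (Polynomial.natDegree_comp_le.trans ?_)
    calc p.natDegree * _ ≤ d * 1 := Nat.mul_le_mul hp Polynomial.natDegree_linear_le
      _ = d := mul_one d
  have hq' : q.degree < (d + 1 : ℕ) := hq.trans_lt (by exact_mod_cast Nat.lt_succ_self d)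
  have hlt : q.degree < (Polynomial.X ^ (d + 1) : Polynomial ℝ).degree := by
    rwa [Polynomial.degree_X_pow]
  have hlim := Polynomial.tendsto_atTop_of_leadingCoeff_nonneg (Polynomial.X ^ (d + 1) - q)
    (by rw [Polynomial.degree_sub_eq_left_of_degree_lt hlt, Polynomial.degree_X_pow]
        exact_mod_cast Nat.succ_pos d)
    (by rw [(Polynomial.monic_X_pow_sub hq').leadingCoeff]; exact zero_le_one)
  obtain ⟨j, hj⟩ := ((hlim.comp tendsto_natCast_atTop_atTop).eventually
    (Filter.eventually_gt_atTop 0)).exists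
  have h1 := hm (j + d) (m + (j + d) * ℓ) le_rfl
  have h2 := hact (m + (j + d) * ℓ)
  have h3 := Nat.pow_le_choose (α := ℝ) (d + 1) (j + d)
  have h4 : ((j + d).choose (d + 1) : ℝ) ≤ p.eval ((m + (j + d) * ℓ : ℕ) : ℝ) :=
    le_trans (by exact_mod_cast h1) h2
  have h5 : ((m + (j + d) * ℓ : ℕ) : ℝ) = ℓ * j + (m + d * ℓ) := by push_cast; ring
  rw [div_le_iff₀ (by positivity), show j + d + 1 - (d + 1) = j by omega] at h3
  rw [h5] at h4
  simp only [Function.comp_apply, Polynomial.eval_sub, Polynomial.eval_pow, Polynomial.eval_X, q,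
    Polynomial.eval_mul, Polynomial.eval_C, Polynomial.eval_comp, Polynomial.eval_add,
    sub_pos] at hj
  have h6 := mul_le_mul_of_nonneg_left h4 (by positivity : (0 : ℝ) ≤ ((d + 1).factorial : ℝ))
  linarith [mul_comm ((j + d).choose (d + 1) : ℝ) ((d + 1).factorial : ℝ)]

end RootedTree

/-! ### Amenability -/

namespace RootedTree

open Boundary TreeAut FinMeasure MulAction

variable {X : Type*}

/-- The action on the words of length at most `n`. -/
def levelHom (X : Type*) (n : ℕ) : TreeAut X →* Equiv.Perm {v : List X // v.length ≤ n} where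
  toFun g := (g : Equiv.Perm (List X)).subtypePerm fun v => by simp
  map_one' := rfl
  map_mul' _ _ := rfl

theorem levelHom_apply (n : ℕ) (g : TreeAut X) (v : {v : List X // v.length ≤ n}) :
    (levelHom X n g v : List X) = g v := rfl

theorem apply_eq_of_levelHom_eq {n : ℕ} {g h : TreeAut X} (hgh : levelHom X n g = levelHom X n h)
    {v : List X} (hv : v.length ≤ n) : g v = h v := by
  rw [← levelHom_apply n g ⟨v, hv⟩, hgh, levelHom_apply]

instance [Finite X] (n : ℕ) : Finite {v : List X // v.length ≤ n} :=
  (List.finite_length_le X n).to_subtype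

/-- Finitely many finitary automorphisms have a common depth `N`, and those of depth `N` form a
finite group. -/
theorem amen_of_deg_zero [Finite X] (G : Subgroup (TreeAut X)) (hG : ∀ g ∈ G, Deg 0 g) :
    Amen G := by
  refine amen_of_locally fun S => ?_
  have hd : ∀ g : G, ∃ n, ∀ v : List X, v.length = n → (g : TreeAut X).sect v = 1 :=
    fun g => hG g g.2
  choose n hn using hd
  let N := ∑ s ∈ S, n s
  let H : Subgroup G :=
    { carrier := {g | ∀ v : List X, v.length = N → (g : TreeAut X).sect v = 1}
      one_mem' := fun v _ => one_sect v
      mul_mem' := fun {a b} ha hb v hv => by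
        rw [Subgroup.coe_mul, mul_sect, ha _ (by simp [hv]), hb v hv, one_mul]
      inv_mem' := fun {a} ha v hv => by
        rw [Subgroup.coe_inv, inv_sect, ha _ ((length_apply _ v).trans hv), inv_one] }
  refine ⟨H, fun s hs v hv => sect_eq_one_of_le (hn s) ?_, ?_⟩
  · rw [hv]
    exact Finset.single_le_sum (f := n) (fun _ _ => Nat.zero_le _) hs
  · have hinj : Function.Injective fun g : H => levelHom X N (g : G) := by
      intro g h hgh
      refine Subtype.ext (Subtype.ext (TreeAut.ext fun y => ?_))
      rcases le_total y.length N with hy | hy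
      · exact apply_eq_of_levelHom_eq hgh hy
      · have hlen : (y.take N).length = N := by simpa using hy
        rw [← List.take_append_drop N y, apply_append_sect, apply_append_sect, g.2 _ hlen,
          h.2 _ hlen, apply_eq_of_levelHom_eq hgh hlen.le]
    have : Finite H := Finite.of_injective _ hinj
    exact amen_of_finite

/-- Extensive amenability on the boundary passes to groups of sections. -/
theorem extAmen_of_sections {G K : Subgroup (TreeAut X)} (h : ExtAmen G (Boundary X)) (u : List X)
    (hK : ∀ k ∈ K, ∃ g ∈ G, g u = u ∧ g.sect u = k) : ExtAmen K (Boundary X) := by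
  classical
  have hK' : ∀ k : K, ∃ g : G, (g : TreeAut X) u = u ∧ (g : TreeAut X).sect u = k := fun k => by
    obtain ⟨g, hg, h⟩ := hK k k.2
    exact ⟨⟨g, hg⟩, h⟩
  choose γ hγ hγs using hK'
  intro y S ε hε
  obtain ⟨p, hp, hpy, hpS⟩ := h (cat u y) (S.image γ) ε hε
  -- Keep the points beginning with `u` and delete `u`; an element fixing `u` acts on them through
  -- its section at `u`.
  let f : Multiset (Boundary X) → Multiset (Boundary X) := fun F =>
    (F.filter fun w => w.pre u.length = u).map (tail u.length)
  refine ⟨Finsupp.mapDomain f p, hp.mapDomain _, fun R hR => ?_, fun s hs => ?_⟩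
  · obtain ⟨F, hF, rfl⟩ := Finset.mem_image.1 (Finsupp.mapDomain_support hR)
    exact Multiset.mem_map.2 ⟨cat u y, Multiset.mem_filter.2 ⟨hpy F hF, pre_cat_length u y⟩,
      tail_cat u y⟩
  · rw [act_mapDomain_hom f (h := γ s), ← FinMeasure.mapDomain_sub]
    · exact (l1_mapDomain_le _ _).trans (hpS _ (Finset.mem_image_of_mem _ hs))
    · intro F
      have hpre : ∀ w : Boundary X, (γ s • w).pre u.length = u ↔ w.pre u.length = u := fun w => by
        rw [Subgroup.smul_def, pre_smul]
        conv_lhs => rw [← hγ s]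
        exact (γ s : TreeAut X).1.injective.eq_iff.trans (by rw [hγ s])
      simp only [f, smul_multiset, Multiset.filter_map, Multiset.map_map, Function.comp_def, hpre]
      refine Multiset.map_congr rfl fun w hw => ?_
      have hw' := (Multiset.mem_filter.1 hw).2
      have e1 : w = cat u (tail u.length w) := by
        conv_lhs => rw [← cat_pre_tail u.length w, hw']
      conv_rhs => rw [e1, Subgroup.smul_def, smul_cat, hγ s, hγs s, tail_cat]
      rfl

/-- The groups of germs at a periodic point. -/
theorem amen_of_cycle [Finite X] {e : ℕ}
    (ih : ∀ L : Subgroup (TreeAut X), (∀ g ∈ L, g.IsFiniteState ∧ Deg e g) →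
      ExtAmen L (Boundary X) → Amen L)
    {G K : Subgroup (TreeAut X)} (h : ExtAmen G (Boundary X)) (u v : List X) (hv0 : v ≠ [])
    (hK : ∀ k ∈ K, ∃ g ∈ G, g u = u ∧ g.sect u = k)
    (hKd : ∀ k ∈ K, k.IsFiniteState ∧ Deg (e + 1) k) (hKv : ∀ k ∈ K, k.sect v = k) : Amen K := by
  have hfin : Amen (Equiv.Perm {w : List X // w.length ≤ v.length}) := amen_of_finite
  refine hfin.of_hom ((levelHom X v.length).comp K.subtype) ?_
  -- `N` fixes all words up to the length of `v`, so taking sections at them is a homomorphism on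
  -- `N`.
  set N := ((levelHom X v.length).comp K.subtype).ker with hN
  have hfix : ∀ g : N, ∀ y : List X, y.length ≤ v.length → (g.1.1 : TreeAut X) y = y :=
    fun g y hy => apply_eq_of_levelHom_eq
      (show levelHom X v.length g.1.1 = levelHom X v.length 1 from MonoidHom.mem_ker.1 g.2) hy
  let ι := {x : List X // x.length = v.length ∧ x ≠ v}
  have : Finite ι := ((List.finite_length_eq X v.length).subset fun x hx => hx.1).to_subtype
  have := Fintype.ofFinite ι
  let f : ι → N →* TreeAut X := fun x =>
    { toFun := fun g => (g.1.1 : TreeAut X).sect x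
      map_one' := one_sect _
      map_mul' := fun a b => by
        simp only [Subgroup.coe_mul]
        rw [mul_sect, hfix b x x.2.1.le] }
  -- The sections at words `x ≠ v` have degree `e`, and they determine `g` because its section at
  -- `v` is `g` again, now applied to a shorter word as `v` is nonempty.
  refine amen_of_finset_hom Finset.univ f (fun x _ => ih _ ?_ ?_) fun g hg => ?_
  · rintro _ ⟨g, rfl⟩
    exact ⟨(hKd _ g.1.2).1.sect _, (hKd _ g.1.2).2.sect_off_cycle (hKv _ g.1.2) x.2.1 x.2.2⟩
  · refine extAmen_of_sections h (u ++ x.1) ?_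
    rintro _ ⟨g, rfl⟩
    obtain ⟨k, hk, hku, hks⟩ := hK _ g.1.2
    refine ⟨k, hk, ?_, ?_⟩
    · rw [apply_append_sect, hku, hks, hfix g x x.2.1.le]
    · rw [sect_append, hks]
      rfl
  · refine Subtype.ext (Subtype.ext (TreeAut.ext fun y => ?_))
    change (g.1.1 : TreeAut X) y = y
    induction hn : y.length using Nat.strong_induction_on generalizing y with
    | _ n ihn =>
      rcases le_total y.length v.length with hy | hy
      · exact hfix g y hy
      · have hlen : (y.take v.length).length = v.length := by simpa using hy
        have hpos : 0 < v.length := List.length_pos_iff.2 hv0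
        have hsect : (g.1.1 : TreeAut X).sect (y.take v.length) (y.drop v.length) =
            y.drop v.length := by
          by_cases hx : y.take v.length = v
          · rw [hx, hKv _ g.1.2]
            exact ihn _ (by rw [List.length_drop]; omega) _ rfl
          · have h1 : (g.1.1 : TreeAut X).sect (y.take v.length) = 1 :=
              hg ⟨_, hlen, hx⟩ (Finset.mem_univ _)
            rw [h1, one_apply']
        conv_lhs => rw [← List.take_append_drop v.length y, apply_append_sect, hsect,
          hfix g _ hlen.le]
        exact List.take_append_drop v.length y

/-- The germ of `g` at `w` is that of an automorphism of degree `e`. -/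
def Tame (e : ℕ) (g : TreeAut X) (w : Boundary X) : Prop := ∃ n, Deg e (g.sect (w.pre n))

theorem Tame.mul {e : ℕ} {g h : TreeAut X} {w : Boundary X} (hg : Tame e g (h • w))
    (hh : Tame e h w) : Tame e (g * h) w := by
  obtain ⟨m, hm⟩ := hg
  obtain ⟨n, hn⟩ := hh
  refine ⟨max m n, ?_⟩
  rw [mul_sect, ← pre_smul]
  exact (hm.sect_pre_of_le (le_max_left _ _)).mul (hn.sect_pre_of_le (le_max_right _ _))

theorem Tame.inv {e : ℕ} {g : TreeAut X} {w : Boundary X} (hg : Tame e g w) :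
    Tame e g⁻¹ (g • w) := by
  obtain ⟨n, hn⟩ := hg
  refine ⟨n, ?_⟩
  rw [inv_sect, ← pre_smul, inv_smul_smul]
  exact hn.inv

theorem tame_one (e : ℕ) (w : Boundary X) : Tame e (1 : TreeAut X) w :=
  ⟨0, by rw [one_sect]; exact deg_one e⟩

theorem finite_not_tame {e : ℕ} {g : TreeAut X} (hg : Deg (e + 1) g) :
    {w : Boundary X | ¬ Tame e g w}.Finite :=
  Set.Finite.subset hg fun _ hw n hn => hw ⟨n, hn⟩

/-! ### The action on germs modulo tame germs. -/

section Germs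

open Pointwise

variable (e : ℕ) (G : Subgroup (TreeAut X))

/-- The class of the unit at `w` modulo tame germs: the point `w` together with the elements of `G`
with target `w` that are tame there. -/
def unitGerm (w : Boundary X) : Boundary X × Set G := (w, {g | Tame e (g : TreeAut X)⁻¹ w})

variable {e G}

/-- Tame germs are closed under composition and inversion, so a tame `s` carries the tame germs
ending at `w` onto those ending at `s • w`. Conversely, the image of the identity germ detects
whether `s` is tame. -/
theorem smul_unitGerm_eq_iff (s : G) (w : Boundary X) :
    s • unitGerm e G w = unitGerm e G (s • w) ↔ Tame e (s : TreeAut X) w := by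
  constructor
  · intro h
    have h1 : s * 1 ∈ s • (unitGerm e G w).2 :=
      Set.smul_mem_smul_set (show Tame e ((1 : G) : TreeAut X)⁻¹ w by
        simpa using tame_one e w)
    have h2 : s * 1 ∈ (unitGerm e G (s • w)).2 := by rw [← h]; exact h1
    have h3 : Tame e (s : TreeAut X)⁻¹ ((s : TreeAut X) • w) := by
      simpa [unitGerm, Subgroup.smul_def] using h2
    simpa using h3.inv
  · intro h
    refine Prod.ext rfl ?_
    change s • {g : G | Tame e (g : TreeAut X)⁻¹ w} =
      {g : G | Tame e (g : TreeAut X)⁻¹ ((s : TreeAut X) • w)}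
    ext g
    rw [Set.mem_smul_set_iff_inv_smul_mem]
    simp only [smul_eq_mul, Set.mem_ofPred_eq, Subgroup.coe_mul, Subgroup.coe_inv, mul_inv_rev,
      inv_inv]
    constructor
    · intro hg
      have h1 : Tame e ((g : TreeAut X)⁻¹ * (s : TreeAut X)) ((s : TreeAut X)⁻¹ • (s : TreeAut X) • w) := by
        simpa using hg
      simpa using h1.mul h.inv
    · exact fun hg => hg.mul h

variable (e G)

/-- The set of germs of elements of `G` modulo tame germs. -/
def germs : SubMulAction G (Boundary X × Set G) where
  carrier := {z | ∃ (g : G) (w : Boundary X), z = g • unitGerm e G w}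
  smul_mem' := by
    rintro s _ ⟨g, w, rfl⟩
    exact ⟨s * g, w, (mul_smul _ _ _).symm⟩

variable {e G}

/-- For the germ of `g` at `w`, the conjugate `g⁻¹ * (k * g)` fixes `w` and has trivial section at a
beginning of `w`, hence is tame there. -/
theorem smul_eq_self_of_sect_eq_one (z : germs e G) (k : G) (hk : k • z.1.1 = z.1.1) (n : ℕ)
    (hkn : (k : TreeAut X).sect (z.1.1.pre n) = 1) : k • z = z := by
  obtain ⟨_, g, w, rfl⟩ := z
  refine Subtype.ext ?_
  change k • g • unitGerm e G w = g • unitGerm e G w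
  replace hk : k • g • w = g • w := hk
  replace hkn : (k : TreeAut X).sect (((g : TreeAut X) • w).pre n) = 1 := hkn
  have hw : (g⁻¹ * (k * g)) • w = w := by
    rw [mul_smul, mul_smul, hk, inv_smul_smul]
  have hku : (k : TreeAut X) ((g : TreeAut X) (w.pre n)) = (g : TreeAut X) (w.pre n) := by
    rw [← pre_smul, ← pre_smul]
    exact congrArg (fun w : Boundary X => w.pre n) hk
  have ht : Tame e ((g⁻¹ * (k * g) : G) : TreeAut X) w := by
    refine ⟨n, ?_⟩
    have h1 : ((g⁻¹ * (k * g) : G) : TreeAut X).sect (w.pre n) =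
        ((g : TreeAut X)⁻¹ * g).sect (w.pre n) := by
      rw [Subgroup.coe_mul, Subgroup.coe_mul, Subgroup.coe_inv, mul_sect, mul_sect (k : TreeAut X),
        mul_apply', hku, ← pre_smul, hkn, one_mul, mul_sect, ← pre_smul]
    rw [h1, inv_mul_cancel, one_sect]
    exact deg_one e
  have h2 := (smul_unitGerm_eq_iff (e := e) _ _).2 ht
  rw [hw, mul_smul, mul_smul, inv_smul_eq_iff] at h2
  exact h2

/-- `s` can take a unit germ to a non-unit only over a non-tame point of `s`, and a non-unit to a
unit only if the new unit lies over a non-tame point of `s⁻¹`. -/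
theorem finite_commensurated {s : G} (hs : Deg (e + 1) (s : TreeAut X)) :
    {z : germs e G | ¬ ((s • z).1 = unitGerm e G (s • z).1.1 ↔ z.1 = unitGerm e G z.1.1)}.Finite :=
    by
  have h1 := (finite_not_tame hs).image (unitGerm e G)
  have h2 := (finite_not_tame hs.inv).image fun w => s⁻¹ • unitGerm e G w
  refine ((h1.union h2).preimage (f := Subtype.val) Subtype.val_injective.injOn).subset ?_
  intro z hz
  by_cases hz1 : z.1 = unitGerm e G z.1.1
  · refine Or.inl ⟨z.1.1, fun ht => hz (iff_of_true ?_ hz1), hz1.symm⟩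
    change s • z.1 = unitGerm e G (s • z.1.1)
    conv_lhs => rw [hz1]
    exact (smul_unitGerm_eq_iff _ _).2 ht
  · have hz2 : s • z.1 = unitGerm e G (s • z.1.1) := by
      by_contra h
      exact hz (iff_of_false h hz1)
    refine Or.inr ⟨s • z.1.1, fun ht => hz1 ?_, ?_⟩
    · have h3 := (smul_unitGerm_eq_iff (e := e) s⁻¹ (s • z.1.1)).2 (by simpa using ht)
      rw [← hz2, inv_smul_smul, inv_smul_smul] at h3
      exact h3
    · change s⁻¹ • unitGerm e G (s • z.1.1) = z.1
      rw [← hz2, inv_smul_smul]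

/-- Projecting germs to their targets leaves a finite set `T` fixing a point `y`. Its elements are
finite-state, so their sections along `y` repeat simultaneously at two beginnings. The group `H` of
all elements with this repetition acts on the orbit of `z` through its sections at `y.pre i`, which
form a group as in `amen_of_cycle`. -/
theorem extAmen_germs [Finite X]
    (ih : ∀ L : Subgroup (TreeAut X), (∀ g ∈ L, g.IsFiniteState ∧ Deg e g) →
      ExtAmen L (Boundary X) → Amen L)
    (hG : ∀ g ∈ G, g.IsFiniteState ∧ Deg (e + 1) g) (h : ExtAmen G (Boundary X)) :
    ExtAmen G (germs e G) := by
  classical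
  refine h.of_fibration (fun z => z.1.1) fun z T hT ε hε => ?_
  set y := z.1.1 with hy
  obtain ⟨i, j, hij, hs⟩ := Set.Finite.exists_lt_map_eq_of_forall_mem
    (f := fun n (t : T) => (t.1 : TreeAut X).sect (y.pre n))
    (t := Set.pi Set.univ fun t : T => Set.range (t.1 : TreeAut X).sect)
    (fun n t _ => ⟨_, rfl⟩) (Set.Finite.pi fun t => (hG _ t.1.2).1)
  obtain ⟨v, hvl, hv⟩ := exists_pre_eq_append y hij.le
  have hpre : ∀ (g : G) n, g • y = y → (g : TreeAut X) (y.pre n) = y.pre n := fun g n hg => by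
    rw [← pre_smul]
    exact congrArg (fun w : Boundary X => w.pre n) hg
  let H : Subgroup G :=
    { carrier := {g | g • y = y ∧
        (g : TreeAut X).sect (y.pre i) = (g : TreeAut X).sect (y.pre j)}
      one_mem' := ⟨one_smul _ _, by simp⟩
      mul_mem' := fun {a b} ha hb => ⟨by rw [mul_smul, hb.1, ha.1], by
        rw [Subgroup.coe_mul, mul_sect, mul_sect, hpre b _ hb.1, hpre b _ hb.1, ha.2, hb.2]⟩
      inv_mem' := fun {a} ha => by
        have h1 : a⁻¹ • y = y := by rw [inv_smul_eq_iff, ha.1]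
        refine ⟨h1, ?_⟩
        have h2 : ∀ n, (a : TreeAut X)⁻¹ (y.pre n) = y.pre n := fun n => hpre a⁻¹ n h1
        rw [Subgroup.coe_inv, inv_sect, inv_sect, h2, h2, ha.2] }
  let σ : H →* TreeAut X :=
    { toFun := fun g => (g.1.1 : TreeAut X).sect (y.pre i)
      map_one' := one_sect _
      map_mul' := fun a b => by
        simp only [Subgroup.coe_mul]
        rw [mul_sect, hpre b.1 _ b.2.1] }
  have hσ : Amen σ.range := by
    refine amen_of_cycle ih h (y.pre i) v (fun h0 => ?_) ?_ ?_ ?_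
    · rw [h0] at hvl
      simp at hvl
      omega
    · rintro _ ⟨g, rfl⟩
      exact ⟨_, g.1.2, hpre g.1 _ g.2.1, rfl⟩
    · rintro _ ⟨g, rfl⟩
      exact ⟨(hG _ g.1.2).1.sect _, (hG _ g.1.2).2.sect _⟩
    · rintro _ ⟨g, rfl⟩
      change ((g.1.1 : TreeAut X).sect (y.pre i)).sect v = (g.1.1 : TreeAut X).sect (y.pre i)
      rw [← sect_append, ← hv]
      exact g.2.2.symm
  obtain ⟨q, hq, hqz, hqT⟩ := exists_of_amen_quotient σ hσ z
    (fun k hk => smul_eq_self_of_sect_eq_one z k.1 k.2.1 i hk) (T.subtype (· ∈ H)) hε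
  refine ⟨q, hq, hqz, fun t ht => ?_⟩
  have htH : t ∈ H := ⟨hT t ht, congrFun hs ⟨t, ht⟩⟩
  exact hqT ⟨t, htH⟩ (by simpa using ht)

end Germs

open Pointwise in
/-- Groups of finite-state automorphisms of bounded degree whose action on the boundary is
extensively amenable are amenable. -/
theorem amen_of_deg [Finite X] (e : ℕ) (G : Subgroup (TreeAut X))
    (hG : ∀ g ∈ G, g.IsFiniteState ∧ Deg e g) (h : ExtAmen G (Boundary X)) : Amen G := by
  induction e generalizing G with
  | zero => exact amen_of_deg_zero G fun g hg => (hG g hg).2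
  | succ e ih =>
    refine (extAmen_germs ih hG h).amen_of_commensurated
      {z | z.1 = unitGerm e G z.1.1} (fun g => finite_commensurated (hG _ g.2).2) fun H hH => ?_
    -- Preserving the unit germs means being tame at every boundary point, hence of degree `e` by
    -- compactness.
    have hdeg : ∀ g ∈ H, Deg e (g : TreeAut X) := by
      intro g hg
      by_contra hd
      obtain ⟨w, hw⟩ := exists_path_not_deg hd
      have h1 : g • unitGerm e G w = unitGerm e G (g • w) :=
        (hH g hg ⟨unitGerm e G w, 1, w, (one_smul _ _).symm⟩).2 rfl
      obtain ⟨n, hn⟩ := (smul_unitGerm_eq_iff g w).1 h1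
      exact hw n hn
    have hK : Amen (H.map G.subtype) := by
      refine ih _ ?_ (extAmen_of_sections h [] ?_)
      · rintro _ ⟨g, hg, rfl⟩
        exact ⟨(hG _ g.2).1, hdeg g hg⟩
      · rintro _ ⟨g, hg, rfl⟩
        exact ⟨g, g.2, List.length_eq_zero_iff.1 (by simp), sect_nil _⟩
    exact hK.of_injective (H.equivMapOfInjective G.subtype G.subtype_injective).toMonoidHom
      (H.equivMapOfInjective G.subtype G.subtype_injective).injective

end RootedTree

/-! ### Invariant means -/

namespace FinMeasure

open Finsupp MulAction Filter

variable {G Y : Type*} [Group G] [MulAction G Y]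

/-- The weight of a set. -/
noncomputable def weight (A : Set Y) : (Y →₀ ℝ) →ₗ[ℝ] ℝ := linearCombination ℝ (A.indicator 1)

theorem weight_eq_sum (A : Set Y) (p : Y →₀ ℝ) :
    weight A p = ∑ y ∈ p.support, p y * A.indicator 1 y := by
  simp [weight, linearCombination_apply, Finsupp.sum]

theorem abs_weight_le (A : Set Y) (p : Y →₀ ℝ) : |weight A p| ≤ l1 p := by
  rw [weight_eq_sum]
  refine (Finset.abs_sum_le_sum_abs _ _).trans (Finset.sum_le_sum fun y _ => ?_)
  rw [abs_mul]
  by_cases hy : y ∈ A <;> simp [hy]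

theorem weight_mem_Icc (A : Set Y) {p : Y →₀ ℝ} (hp : IsProb p) :
    weight A p ∈ Set.Icc (0 : ℝ) 1 := by
  refine ⟨?_, (le_abs_self _).trans ((abs_weight_le A p).trans hp.l1_le_one)⟩
  rw [weight_eq_sum]
  exact Finset.sum_nonneg fun y _ => mul_nonneg (hp.nonneg y)
    (Set.indicator_nonneg (fun _ _ => zero_le_one) y)

theorem weight_image_act (g : G) (A : Set Y) (p : Y →₀ ℝ) :
    weight ((fun y => g • y) '' A) (act g p) = weight A p := by
  rw [weight, act, linearCombination_mapDomain, weight]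
  congr 2
  funext y
  by_cases hy : y ∈ A <;> simp [Set.indicator, hy]

open RootedTree in
/-- Almost invariant measures yield an invariant mean. -/
theorem Reiter.isAmenableAction (h : Reiter G Y) : IsAmenableAction G Y := by
  classical
  have hex : ∀ i : Finset G × ℕ, ∃ p : Y →₀ ℝ, IsProb p ∧
      ∀ s ∈ i.1, l1 (act s p - p) ≤ 1 / ((i.2 : ℝ) + 1) :=
    fun i => h i.1 _ (by positivity)
  choose p hp hpS using hex
  -- The mean is the limit of the weights along an ultrafilter on pairs of a finite set and a
  -- precision, refining `atTop`.
  let U : Ultrafilter (Finset G × ℕ) := Ultrafilter.of atTop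
  have hU : (U : Filter (Finset G × ℕ)) ≤ atTop := Ultrafilter.of_le _
  have hlim : ∀ A : Set Y, ∃ a ∈ Set.Icc (0 : ℝ) 1,
      Tendsto (fun i => weight A (p i)) U (nhds a) := fun A =>
    isCompact_Icc.ultrafilter_le_nhds (U.map fun i => weight A (p i))
      (le_principal_iff.2 (Eventually.of_forall (f := (U : Filter (Finset G × ℕ)))
        fun i => weight_mem_Icc A (hp i)))
  choose m hm hmlim using hlim
  refine ⟨m, hm, ?_, fun A B hAB => ?_, fun g A => ?_⟩
  · refine tendsto_nhds_unique (hmlim Set.univ) ?_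
    have : ∀ i, weight Set.univ (p i) = 1 := fun i => by
      rw [← (hp i).mass_eq_one]
      simp [weight, mass, Pi.one_def]
    simp only [this]
    exact tendsto_const_nhds
  · refine tendsto_nhds_unique (hmlim (A ∪ B)) ?_
    have : ∀ i, weight (A ∪ B) (p i) = weight A (p i) + weight B (p i) := fun i => by
      simp only [weight_eq_sum, Set.indicator_union_of_disjoint hAB, mul_add,
        Finset.sum_add_distrib]
    simp only [this]
    exact (hmlim A).add (hmlim B)
  · refine tendsto_nhds_unique (hmlim _) ?_
    have h0 : Tendsto (fun i => weight ((fun y => g • y) '' A) (p i) - weight A (p i)) U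
        (nhds 0) := by
      have h1 : Tendsto (fun i : Finset G × ℕ => 1 / ((i.2 : ℝ) + 1)) U (nhds 0) :=
        (tendsto_one_div_add_atTop_nhds_zero_nat.comp
          (tendsto_snd.comp prod_atTop_atTop_eq.ge)).mono_left hU
      refine squeeze_zero_norm' ?_ h1
      filter_upwards [hU (eventually_ge_atTop (({g}, 0) : Finset G × ℕ))] with i hi
      rw [Real.norm_eq_abs, ← weight_image_act g A (p i), ← map_sub]
      refine (abs_weight_le _ _).trans ?_
      rw [l1_sub_comm]
      exact hpS i g (hi.1 (Finset.mem_singleton_self g))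
    simpa using h0.add (hmlim A)

theorem extAmen_of_orbits (h : ∀ y : Y, ExtAmen G (orbit G y)) : ExtAmen G Y := by
  intro y S ε hε
  obtain ⟨p, hp, hpy, hpS⟩ := h y ⟨y, mem_orbit_self y⟩ S ε hε
  refine ⟨mapDomain (Multiset.map Subtype.val) p, hp.mapDomain _, fun R hR => ?_, fun s hs =>
    l1_act_mapDomain_sub_le s hp (hpS s hs) fun F _ => ?_⟩
  · classical
    obtain ⟨F, hF, rfl⟩ := Finset.mem_image.1 (mapDomain_support hR)
    exact Multiset.mem_map_of_mem Subtype.val (hpy F hF)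
  · simp only [smul_multiset, Multiset.map_map]
    rfl

end FinMeasure

theorem mainTheorem8 (X : Type*) [Finite X] (G : Subgroup (RootedTree.TreeAut X))
    (hG : G ≤ RootedTree.polyActivity X 2) (hfg : G.FG)
    (hrec : ∀ w : RootedTree.Boundary X,
      RootedTree.IsRecurrentAction G (MulAction.orbit G w)) :
    RootedTree.IsAmenableGroup G :=
  FinMeasure.Reiter.isAmenableAction <|
    RootedTree.amen_of_deg 3 G
      (fun _ hg => ⟨(hG hg).1, RootedTree.deg_of_mem_polyActivity (hG hg)⟩)
      (FinMeasure.extAmen_of_orbits fun w => (hrec w).extAmen)
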